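/- Let $\Gamma$ be a group. Suppose that $\alpha_1,\alpha_2,\beta_1,\beta_2\in\Gamma$ commute with one another and are all conjugate to one another in $\Gamma$. Let $A=\langle\alpha_1,\alpha_2,\beta_1,\beta_2\rangle$, write $Z_\Gamma(g)$ for the centralizer of $g$ in $\Gamma$, and suppose that (i) $\alpha_1\alpha_2=\beta_1\beta_2$; (ii) $\alpha_1\in[Z_\Gamma(\alpha_2),Z_\Gamma(\alpha_2)]$ and $\beta_1\in[Z_\Gamma(\beta_2),Z_\Gamma(\beta_2)]$; (iii) there exists $\gamma\in Z_\Gamma(\beta_1\beta_2^{-1})$ with $\gamma^{-1}(\alpha_1\alpha_2^{-1})\gamma=\alpha_2\alpha_1^{-1}$. Then, whenever $\Gamma$ acts by semisimple isometries on a complete CAT$(0)$ space $X$ (that is, for each $g\in\Gamma$ the infimum of $d(x,g.x)$ over $x\in X$ is attained), either $A$ fixes a point of $X$, or there is an isometrically embedded 3-flat $\mathbb E^3\hookrightarrow X$ that is invariant under $A$ and on which $A$ acts properly and cocompactly by translations, in such a way that the Dirichlet domain $\{x\in\mathbb E^3 \mid d(x,p)\le d(x,a.p)\ \text{for all } a\in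 A\}$ centred at any point $p\in\mathbb E^3$ is a rhombic dodecahedron. (A rhombic dodecahedron is the image, under a similarity of $\mathbb R^3$, of the convex hull of the six points $\pm e_1,\pm e_2,\pm e_3$ and the eight points $(\pm\frac12,\pm\frac12,\pm\frac12)$.) -/

import Mathlib

/-- Euclidean space of dimension `n`. -/
abbrev Euc (n : ℕ) : Type := EuclideanSpace ℝ (Fin n)

/-- `c`, restricted to `[0, 1]`, is a geodesic from `x` to `y`, parametrised proportionally to
arc length. -/
structure IsGeodesicFromTo {X : Type*} [MetricSpace X] (c : ℝ → X) (x y : X) : Prop where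
  start : c 0 = x
  finish : c 1 = y
  dist_eq : ∀ s ∈ Set.Icc (0 : ℝ) 1, ∀ t ∈ Set.Icc (0 : ℝ) 1,
    dist (c s) (c t) = |s - t| * dist x y

/-- A CAT(0) space: a geodesic metric space in which no geodesic triangle is fatter than its
comparison triangle `x' y' z'` in the Euclidean plane. Two points that lie on different sides of a
geodesic triangle lie on two sides that issue from a common vertex, here called `x` (for two points
of the same side the comparison is an equality); the third side exists because the space is
geodesic. -/
structure IsCAT0 (X : Type*) [MetricSpace X] : Prop where
  geodesic : ∀ x y : X, ∃ c : ℝ → X, IsGeodesicFromTo c x y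
  comparison : ∀ (x y z : X) (c₁ c₂ : ℝ → X),
    IsGeodesicFromTo c₁ x y → IsGeodesicFromTo c₂ x z →
    ∀ x' y' z' : Euc 2, dist x' y' = dist x y → dist y' z' = dist y z → dist x' z' = dist x z →
    ∀ s ∈ Set.Icc (0 : ℝ) 1, ∀ t ∈ Set.Icc (0 : ℝ) 1,
      dist (c₁ s) (c₂ t) ≤ dist (AffineMap.lineMap x' y' s : Euc 2) (AffineMap.lineMap x' z' t)

/-- The translation length of `g : X → X`, the infimum of the displacements `d(x, g x)`. -/
noncomputable def translationLength {X : Type*} [MetricSpace X] (g : X → X) : ℝ :=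
  ⨅ x, dist x (g x)

/-- `Min(g)`, the set of points at which the translation length is attained. -/
def minSet {X : Type*} [MetricSpace X] (g : X → X) : Set X :=
  {x | dist x (g x) = translationLength g}

/-- `g` is semisimple if `Min(g)` is non-empty. (In particular `X` is then non-empty.) -/
def IsSemisimpleMap {X : Type*} [MetricSpace X] (g : X → X) : Prop :=
  (minSet g).Nonempty

/-- The subgroup `A` acts properly on the subset `F` of `X`: each point of `F` has a ball of `F`
around it that meets only finitely many of its translates under elements of `A`. -/
def ActsProperlyOn {Γ X : Type*} [Group Γ] [MetricSpace X] [MulAction Γ X]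
    (A : Subgroup Γ) (F : Set X) : Prop :=
  ∀ x ∈ F, ∃ r > 0,
    {a : Γ | a ∈ A ∧ ∃ y ∈ Metric.ball x r ∩ F, a • y ∈ Metric.ball x r ∩ F}.Finite

/-- The subgroup `A` acts cocompactly on the subset `F` of `X`: the translates of some compact
`K ⊆ F` cover `F`. -/
def ActsCocompactlyOn {Γ X : Type*} [Group Γ] [MetricSpace X] [MulAction Γ X]
    (A : Subgroup Γ) (F : Set X) : Prop :=
  ∃ K : Set X, K ⊆ F ∧ IsCompact K ∧ ∀ x ∈ F, ∃ a ∈ A, ∃ y ∈ K, x = a • y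

/-- The Dirichlet domain, centred at `p`, for the action of the subgroup `A` on the subset `F`. -/
def dirichletDomain {Γ X : Type*} [Group Γ] [MetricSpace X] [MulAction Γ X]
    (A : Subgroup Γ) (F : Set X) (p : X) : Set X :=
  {x | x ∈ F ∧ ∀ a ∈ A, dist x p ≤ dist x (a • p)}

/-- The rhombic dodecahedron constructed in the tiling of `ℝ³` by unit cubes with vertices in `ℤ³`:
the convex hull of the endpoints of the six edges incident at the origin and of the centres
of the eight cubes incident at the origin. -/
def standardRhombicDodecahedron : Set (Euc 3) :=
  convexHull ℝ
    ({x | ∃ i : Fin 3, x = EuclideanSpace.single i 1 ∨ x = EuclideanSpace.single i (-1)} ∪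
      {x | ∀ i : Fin 3, x i = 1 / 2 ∨ x i = -1 / 2})

/-- A rhombic dodecahedron is the image of the standard one under a similarity of `ℝ³`. -/
def IsRhombicDodecahedron (S : Set (Euc 3)) : Prop :=
  ∃ r : ℝ, 0 < r ∧ ∃ φ : Euc 3 → Euc 3, (∀ x y, dist (φ x) (φ y) = r * dist x y) ∧
    S = φ '' standardRhombicDodecahedron

/-! Commuting semisimple isometries have a common point `x` in their sets `Min`
(`exists_forall_mem_smulMin`). At such a point `axialCoord g x (h • x)` is the inner product ⟨g, h⟩
of the translation vectors of g and h. It is symmetric (`axialCoord_comm`), and in h it is a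
homomorphism from the centralizer of g to ℝ (`axialCoord_mul`, resting on `axialCoord_add`), defined
without reference to any flat. It therefore vanishes on commutators of that centralizer, and on
elements conjugate there to their inverses.

Conjugacy gives all four elements one translation length l; if l = 0, then A fixes `x`. Otherwise
(ii) gives α₁ ⊥ α₂ and β₁ ⊥ β₂, and (iii) gives α₁ - α₂ ⊥ β₁ - β₂. Since α₁ + α₂ = β₁ + β₂ is
orthogonal to α₁ - α₂, so is β₁; hence ⟨β₁, α₁⟩ = ⟨β₁, α₂⟩ = l²/2. This is the Gram matrix of
k(1,1,0), k(1,-1,0), k(1,0,1) with l² = 2k², a basis of the face-centred cubic lattice. Flowing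
along the axes of α₁, α₂, β₁ embeds a Euclidean 3-space with this metric (`exists_flat`), and the
Voronoi cells of the lattice are rhombic dodecahedra. -/

namespace IsCAT0

/-! ### Convexity and nearest-point projection in CAT(0) spaces. -/

theorem exists_comparison_triangle {X : Type*} [MetricSpace X] (x y z : X) :
    ∃ x' y' z' : Euc 2, dist x' y' = dist x y ∧ dist y' z' = dist y z ∧
      dist x' z' = dist x z := by
  rcases eq_or_ne x y with rfl | hxy
  · refine ⟨0, 0, !₂[dist x z, 0], ?_, ?_, ?_⟩ <;>
      simp [EuclideanSpace.dist_eq, Real.dist_eq]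
  · have hc : 0 < dist x y := dist_pos.2 hxy
    set c := dist x y
    set a := dist y z
    set b := dist x z
    have ha : 0 ≤ a := dist_nonneg
    have hb : 0 ≤ b := dist_nonneg
    have h1 : a ≤ c + b := by
      simpa [a, b, c, dist_comm y x] using dist_triangle y x z
    have h2 : b ≤ c + a := dist_triangle x y z
    have h3 : c ≤ b + a := by
      simpa [a, b, c, dist_comm z y] using dist_triangle x z y
    -- Law of cosines: the abscissa of z' when x' = 0 and y' = (c, 0).
    set u := (b ^ 2 + c ^ 2 - a ^ 2) / (2 * c) with hu
    have huc : 2 * c * u = b ^ 2 + c ^ 2 - a ^ 2 := by rw [hu]; field_simp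
    have hub : 0 ≤ b ^ 2 - u ^ 2 := by
      have h4 : 0 ≤ (2 * c) * (b - u) := by nlinarith
      have h5 : 0 ≤ (2 * c) * (b + u) := by nlinarith
      have h6 : 0 ≤ b - u := nonneg_of_mul_nonneg_right h4 (by positivity)
      have h7 : 0 ≤ b + u := nonneg_of_mul_nonneg_right h5 (by positivity)
      nlinarith
    have hv := Real.sq_sqrt hub
    refine ⟨0, !₂[c, 0], !₂[u, √(b ^ 2 - u ^ 2)], ?_, ?_, ?_⟩
    · simp [EuclideanSpace.dist_eq, Real.dist_eq, Real.sqrt_sq_eq_abs, abs_of_pos hc]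
    · rw [EuclideanSpace.dist_eq, Real.sqrt_eq_iff_eq_sq (by positivity) ha]
      simp only [Fin.sum_univ_two, Real.dist_eq, sq_abs]
      simp
      nlinarith
    · rw [EuclideanSpace.dist_eq, Real.sqrt_eq_iff_eq_sq (by positivity) hb]
      simp only [Fin.sum_univ_two, Real.dist_eq, sq_abs]
      simp
      nlinarith

theorem dist_lineMap_sq (x y z : Euc 2) (t : ℝ) :
    dist (AffineMap.lineMap x y t : Euc 2) z ^ 2 =
      (1 - t) * dist x z ^ 2 + t * dist y z ^ 2 - t * (1 - t) * dist x y ^ 2 := by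
  simp only [EuclideanSpace.dist_eq, Fin.sum_univ_two, Real.dist_eq, sq_abs,
    Real.sq_sqrt (add_nonneg (sq_nonneg _) (sq_nonneg _)), AffineMap.lineMap_apply]
  simp
  ring

variable {X : Type*} [MetricSpace X]

/-- The CN inequality of Bruhat and Tits. -/
theorem dist_sq_le (hX : IsCAT0 X) {c : ℝ → X} {x y : X} (hc : IsGeodesicFromTo c x y) {t : ℝ}
    (ht : t ∈ Set.Icc (0 : ℝ) 1) (z : X) :
    dist (c t) z ^ 2 ≤ (1 - t) * dist x z ^ 2 + t * dist y z ^ 2 - t * (1 - t) * dist x y ^ 2 := by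
  obtain ⟨x', y', z', h1, h2, h3⟩ := exists_comparison_triangle x y z
  obtain ⟨c', hc'⟩ := hX.geodesic x z
  have h := hX.comparison x y z c c' hc hc' x' y' z' h1 h2 h3 t ht 1 (by simp)
  rw [hc'.finish, AffineMap.lineMap_apply_one] at h
  rw [← h1, ← h2, ← h3, ← dist_lineMap_sq]
  gcongr

theorem exists_midpoint (hX : IsCAT0 X) (x y : X) :
    ∃ m, ∀ z, dist m z ^ 2 ≤ dist x z ^ 2 / 2 + dist y z ^ 2 / 2 - dist x y ^ 2 / 4 := by
  obtain ⟨c, hc⟩ := hX.geodesic x y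
  refine ⟨c (1 / 2), fun z => ?_⟩
  have := hX.dist_sq_le hc (t := 1 / 2) (by constructor <;> norm_num) z
  linarith

/-- Midpoints are unique: the CN inequality for one midpoint, evaluated at another, bounds their
distance by 0. -/
theorem dist_sq_le_of_isMidpoint (hX : IsCAT0 X) {x y m : X} (hx : dist m x = dist x y / 2)
    (hy : dist m y = dist x y / 2) (z : X) :
    dist m z ^ 2 ≤ dist x z ^ 2 / 2 + dist y z ^ 2 / 2 - dist x y ^ 2 / 4 := by
  obtain ⟨n, hn⟩ := hX.exists_midpoint x y
  have h := hn m
  rw [dist_comm x m, dist_comm y m, hx, hy] at h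
  have h0 : dist n m = 0 := by
    have : dist n m ^ 2 ≤ 0 := by linarith
    exact pow_eq_zero_iff (two_ne_zero) |>.1 (le_antisymm this (sq_nonneg _))
  rw [← dist_eq_zero.1 h0]
  exact hn z

/-- The sum of the squares of the diagonals of a quadrilateral is at most the sum of the squares
of its sides. -/
theorem quadrilateral (hX : IsCAT0 X) (a b c d : X) :
    dist a c ^ 2 + dist b d ^ 2 ≤
      dist a b ^ 2 + dist b c ^ 2 + dist c d ^ 2 + dist d a ^ 2 := by
  obtain ⟨m, hm⟩ := hX.exists_midpoint a c
  have h1 := hm b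
  have h2 := hm d
  have h3 := dist_triangle_left b d m
  have h4 : dist b d ^ 2 ≤ (dist m b + dist m d) ^ 2 := by gcongr
  have h5 := sq_nonneg (dist m b - dist m d)
  rw [dist_comm c b] at h1
  rw [dist_comm a d] at h2
  nlinarith

/-- A subset is geodesically convex if it contains the geodesics between its points. -/
def GeodConvex (C : Set X) : Prop :=
  ∀ ⦃x⦄, x ∈ C → ∀ ⦃y⦄, y ∈ C → ∀ ⦃c : ℝ → X⦄, IsGeodesicFromTo c x y →
    ∀ t ∈ Set.Icc (0 : ℝ) 1, c t ∈ C

/-- A minimizing sequence is Cauchy: the midpoint of two of its terms lies in `C`, hence is no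
closer to `x` than the infimum, and the CN inequality then forces the terms together. -/
theorem exists_nearest [CompleteSpace X] (hX : IsCAT0 X) {C : Set X} (hne : C.Nonempty)
    (hcl : IsClosed C) (hconv : GeodConvex C) (x : X) :
    ∃ p ∈ C, ∀ q ∈ C, dist p x ≤ dist q x := by
  set D := Metric.infDist x C
  have hD : ∀ q ∈ C, D ≤ dist q x := fun q hq => by
    rw [dist_comm]; exact Metric.infDist_le_dist_of_mem hq
  have hD0 : 0 ≤ D := Metric.infDist_nonneg
  have key : ∀ q ∈ C, ∀ q' ∈ C,
      dist q q' ^ 2 ≤ 2 * (dist q x ^ 2 - D ^ 2) + 2 * (dist q' x ^ 2 - D ^ 2) := by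
    intro q hq q' hq'
    obtain ⟨c, hc⟩ := hX.geodesic q q'
    have hm : (1 / 2 : ℝ) ∈ Set.Icc (0 : ℝ) 1 := by constructor <;> norm_num
    have h1 := hX.dist_sq_le hc hm x
    have h2 := hD _ (hconv hq hq' hc _ hm)
    have h3 : D ^ 2 ≤ dist (c (1 / 2)) x ^ 2 := by gcongr
    linarith
  have hex : ∀ n : ℕ, ∃ q ∈ C, dist q x ^ 2 < D ^ 2 + 1 / ((n : ℝ) + 1) := by
    intro n
    have h1 : D < √(D ^ 2 + 1 / ((n : ℝ) + 1)) := by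
      apply Real.lt_sqrt_of_sq_lt
      have : (0 : ℝ) < 1 / ((n : ℝ) + 1) := by positivity
      linarith
    obtain ⟨q, hq, hlt⟩ := (Metric.infDist_lt_iff hne).1 h1
    refine ⟨q, hq, ?_⟩
    rw [dist_comm]
    exact (Real.lt_sqrt dist_nonneg).1 hlt
  choose q hq hlt using hex
  have hlim0 : Filter.Tendsto (fun n : ℕ => 1 / ((n : ℝ) + 1)) Filter.atTop (nhds 0) :=
    tendsto_one_div_add_atTop_nhds_zero_nat
  have hcau : CauchySeq q := by
    refine cauchySeq_of_le_tendsto_0 (fun n : ℕ => √(4 * (1 / ((n : ℝ) + 1)))) ?_ ?_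
    · intro n m N hn hm
      apply Real.le_sqrt_of_sq_le
      have h1 := key _ (hq n) _ (hq m)
      have h2 := hlt n
      have h3 := hlt m
      have h4 : 1 / ((n : ℝ) + 1) ≤ 1 / ((N : ℝ) + 1) := by gcongr
      have h5 : 1 / ((m : ℝ) + 1) ≤ 1 / ((N : ℝ) + 1) := by gcongr
      linarith
    · have := (Real.continuous_sqrt.tendsto _).comp (hlim0.const_mul 4)
      rw [mul_zero, Real.sqrt_zero] at this
      exact this
  obtain ⟨p, hp⟩ := cauchySeq_tendsto_of_complete hcau
  refine ⟨p, hcl.mem_of_tendsto hp (Filter.Eventually.of_forall hq), fun r hr => ?_⟩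
  have h1 : Filter.Tendsto (fun n => dist (q n) x ^ 2) Filter.atTop (nhds (dist p x ^ 2)) :=
    (hp.dist tendsto_const_nhds).pow 2
  have h2 : Filter.Tendsto (fun n : ℕ => D ^ 2 + 1 / ((n : ℝ) + 1)) Filter.atTop
      (nhds (D ^ 2 + 0)) := tendsto_const_nhds.add hlim0
  have h3 := le_of_tendsto_of_tendsto' h1 h2 fun n => (hlt n).le
  rw [add_zero] at h3
  exact (abs_le_of_sq_le_sq' h3 hD0).2.trans (hD r hr)

/-- The angle at the projection `p` is not acute. Compare `p` with the point at time t on the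
geodesic to `q`, divide by t and let t tend to 0. -/
theorem dist_sq_add_le_of_nearest (hX : IsCAT0 X) {C : Set X} (hconv : GeodConvex C) {x p q : X}
    (hp : p ∈ C) (hmin : ∀ q ∈ C, dist p x ≤ dist q x) (hq : q ∈ C) :
    dist p x ^ 2 + dist p q ^ 2 ≤ dist q x ^ 2 := by
  obtain ⟨c, hc⟩ := hX.geodesic p q
  have key : ∀ t : ℝ, 0 < t → t ≤ 1 →
      dist p x ^ 2 + (1 - t) * dist p q ^ 2 ≤ dist q x ^ 2 := by
    intro t ht ht1
    have h1 := hX.dist_sq_le hc ⟨ht.le, ht1⟩ x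
    have h2 := hmin _ (hconv hp hq hc t ⟨ht.le, ht1⟩)
    have h3 : dist p x ^ 2 ≤ dist (c t) x ^ 2 := by gcongr
    have h4 : t * (dist p x ^ 2 + (1 - t) * dist p q ^ 2) ≤ t * dist q x ^ 2 := by linarith
    exact le_of_mul_le_mul_left h4 ht
  have hlim : Filter.Tendsto (fun t : ℝ => dist p x ^ 2 + (1 - t) * dist p q ^ 2)
      (nhdsWithin 0 (Set.Ioi 0)) (nhds (dist p x ^ 2 + (1 - 0) * dist p q ^ 2)) := by
    apply Filter.Tendsto.mono_left _ nhdsWithin_le_nhds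
    exact Continuous.tendsto (by fun_prop) 0
  rw [sub_zero, one_mul] at hlim
  refine le_of_tendsto hlim ?_
  filter_upwards [Ioc_mem_nhdsGT (zero_lt_one : (0 : ℝ) < 1)] with t ht using key t ht.1 ht.2

/-- Projection does not increase distances: add the two Pythagorean inequalities at `p` and `q` to
the quadrilateral inequality. -/
theorem dist_nearest_le (hX : IsCAT0 X) {C : Set X} (hconv : GeodConvex C) {x y p q : X}
    (hp : p ∈ C) (hpm : ∀ r ∈ C, dist p x ≤ dist r x)
    (hq : q ∈ C) (hqm : ∀ r ∈ C, dist q y ≤ dist r y) : dist p q ≤ dist x y := by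
  have h1 := hX.dist_sq_add_le_of_nearest hconv hp hpm hq
  have h2 := hX.dist_sq_add_le_of_nearest hconv hq hqm hp
  have h3 := hX.quadrilateral x p q y
  rw [dist_comm q p] at h2
  rw [dist_comm x p, dist_comm x q, dist_comm y x] at h3
  refine (abs_le_of_sq_le_sq' (a := dist p q) (b := dist x y) ?_ dist_nonneg).2
  linarith

end IsCAT0

/-! ### Translation lengths and sets `Min` of commuting isometries. -/

section MinSets

variable {Γ X : Type*} [Group Γ] [MetricSpace X] [MulAction Γ X]

/-- The translation length of the isometry by which `g` acts on `X`. -/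
noncomputable abbrev smulLength (X : Type*) [MetricSpace X] [MulAction Γ X] (g : Γ) : ℝ :=
  translationLength (fun x : X => g • x)

/-- The set of points of `X` that `g` moves as little as possible. -/
abbrev smulMin (X : Type*) [MetricSpace X] [MulAction Γ X] (g : Γ) : Set X :=
  minSet (fun x : X => g • x)

theorem smulLength_le (g : Γ) (x : X) : smulLength X g ≤ dist x (g • x) :=
  ciInf_le (f := fun x : X => dist x (g • x))
    ⟨0, by rintro _ ⟨y, rfl⟩; exact dist_nonneg⟩ x

theorem smulLength_nonneg (g : Γ) : 0 ≤ smulLength X g :=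
  Real.iInf_nonneg fun _ => dist_nonneg

theorem mem_smulMin {g : Γ} {x : X} : x ∈ smulMin X g ↔ dist x (g • x) = smulLength X g :=
  Iff.rfl

theorem mem_smulMin_of_le {g : Γ} {x : X} (h : dist x (g • x) ≤ smulLength X g) :
    x ∈ smulMin X g :=
  le_antisymm h (smulLength_le g x)

variable [IsIsometricSMul Γ X]

theorem smulLength_eq_of_isConj {g h : Γ} (hgh : IsConj g h) :
    smulLength X g = smulLength X h := by
  obtain ⟨c, rfl⟩ := isConj_iff.1 hgh
  refine Equiv.iInf_congr (MulAction.toPerm c) fun x => ?_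
  simp [mul_smul, dist_smul]

theorem smul_mem_smulMin {g h : Γ} (hgh : Commute g h) {x : X} (hx : x ∈ smulMin X g) :
    h • x ∈ smulMin X g := by
  rw [mem_smulMin, smul_smul, hgh.eq, mul_smul, dist_smul]
  exact hx

theorem isClosed_smulMin (g : Γ) : IsClosed (smulMin X g) :=
  isClosed_eq (continuous_id.dist (continuous_const_smul g)) continuous_const

theorem IsGeodesicFromTo.smul {c : ℝ → X} {x y : X} (hc : IsGeodesicFromTo c x y) (g : Γ) :
    IsGeodesicFromTo (fun t => g • c t) (g • x) (g • y) where
  start := by rw [hc.start]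
  finish := by rw [hc.finish]
  dist_eq s hs t ht := by rw [dist_smul, dist_smul, hc.dist_eq s hs t ht]

namespace IsCAT0

theorem geodConvex_smulMin (hX : IsCAT0 X) (g : Γ) : GeodConvex (smulMin X g) := by
  intro x hx y hy c hc t ht
  apply mem_smulMin_of_le
  rw [mem_smulMin] at hx hy
  have hl : 0 ≤ smulLength X g := smulLength_nonneg g
  have h1 := hX.dist_sq_le (hc.smul g) ht (c t)
  have h2 := hX.dist_sq_le hc ht (g • x)
  have h3 := hX.dist_sq_le hc ht (g • y)
  have h4 := hX.quadrilateral x (g • x) (g • y) y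
  rw [dist_comm (g • y) y, dist_comm (g • x) y, dist_comm y x] at h4
  rw [dist_comm (g • c t), dist_comm (g • x) (c t), dist_comm (g • y) (c t)] at h1
  simp only [dist_smul, hx, hy] at h1 h2 h3 h4
  obtain ⟨ht0, ht1⟩ := ht
  refine (abs_le_of_sq_le_sq' ?_ hl).2
  -- With weights 1 - t, t and t(1 - t) the terms in d(x, y), d(x, gy) and d(y, gx) cancel, and the
  -- coefficients of l² add up to 1.
  have h5 := mul_le_mul_of_nonneg_left h2 (sub_nonneg.2 ht1)
  have h6 := mul_le_mul_of_nonneg_left h3 ht0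
  have h7 := mul_le_mul_of_nonneg_left h4 (mul_nonneg ht0 (sub_nonneg.2 ht1))
  linarith

/-- A semisimple isometry attains its translation length on every invariant closed convex set. -/
theorem exists_mem_smulMin [CompleteSpace X] (hX : IsCAT0 X) {C : Set X} (hne : C.Nonempty)
    (hcl : IsClosed C) (hconv : GeodConvex C) {g : Γ} (hg : (smulMin X g).Nonempty)
    (hC : ∀ x, g • x ∈ C ↔ x ∈ C) : ∃ x ∈ C, x ∈ smulMin X g := by
  obtain ⟨x, hx⟩ := hg
  obtain ⟨p, hp, hpm⟩ := hX.exists_nearest hne hcl hconv x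
  refine ⟨p, hp, mem_smulMin_of_le ?_⟩
  rw [← mem_smulMin.1 hx]
  -- By invariance of `C`, the projection of `g • x` is `g • p`, so projecting does not increase the
  -- displacement.
  refine hX.dist_nearest_le hconv hp hpm ((hC p).2 hp) fun r hr => ?_
  have h : g⁻¹ • r ∈ C := (hC _).1 (by simpa using hr)
  rw [dist_smul]
  refine (hpm _ h).trans_eq ?_
  rw [← dist_smul g, smul_inv_smul]

/-- The sets `Min` of the elements already treated meet in a closed convex set, which the next
element preserves because it commutes with them. -/
theorem exists_forall_mem_smulMin [CompleteSpace X] (hX : IsCAT0 X)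
    (hss : ∀ g : Γ, (smulMin X g).Nonempty) (l : List Γ)
    (hl : ∀ a ∈ l, ∀ b ∈ l, Commute a b) : ∃ x : X, ∀ a ∈ l, x ∈ smulMin X a := by
  induction l with
  | nil =>
    obtain ⟨x, -⟩ := hss (1 : Γ)
    exact ⟨x, by simp⟩
  | cons b l ih =>
    have ih := ih fun a ha c hc => hl a (by simp [ha]) c (by simp [hc])
    have hb : ∀ a ∈ l, Commute a b := fun a ha => hl a (by simp [ha]) b (by simp)
    obtain ⟨x, hx, hxb⟩ := hX.exists_mem_smulMin (C := {x | ∀ a ∈ l, x ∈ smulMin X a}) (g := b)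
      ih (by
        simp only [Set.ofPred_forall]
        exact isClosed_iInter fun a => isClosed_iInter fun _ => isClosed_smulMin a)
      (fun x hx y hy c hc t ht a ha => hX.geodConvex_smulMin a (hx a ha) (hy a ha) hc t ht)
      (hss b) (fun x => ⟨fun h a ha => by
          simpa using smul_mem_smulMin (hb a ha).inv_right (h a ha),
        fun h a ha => smul_mem_smulMin (hb a ha) (h a ha)⟩)
    refine ⟨x, fun a ha => ?_⟩
    rcases List.mem_cons.1 ha with rfl | ha
    · exact hxb
    · exact hx a ha

/-- If m is the midpoint of x and gx, then gm is the midpoint of gx and g²x, and comparing midpoints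
gives d(m, gm) ≤ d(x, g²x) / 2. -/
theorem two_mul_smulLength_le (hX : IsCAT0 X) (g : Γ) (x : X) :
    2 * smulLength X g ≤ dist x (g ^ 2 • x) := by
  obtain ⟨m, hm⟩ := hX.exists_midpoint x (g • x)
  have h1 := hm (g • m)
  have h2 := hm (g ^ 2 • x)
  have h3 := hm x
  have h4 := hm (g • x)
  have h5 := smulLength_le g m
  have h6 : dist x (g • m) ^ 2 = dist (g⁻¹ • x) m ^ 2 := by
    rw [← dist_smul g (g⁻¹ • x), smul_inv_smul]
  have h7 : dist (g • x) (g • m) = dist m x := by rw [dist_smul, dist_comm]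
  have h8 : ∀ z, dist (g • m) z ^ 2 ≤ dist (g • x) z ^ 2 / 2 + dist (g ^ 2 • x) z ^ 2 / 2 -
      dist x (g • x) ^ 2 / 4 := by
    intro z
    have := hm (g⁻¹ • z)
    rw [← dist_smul g, ← dist_smul g x (g⁻¹ • z), ← dist_smul g (g • x) (g⁻¹ • z),
      smul_inv_smul, smul_smul g g, ← sq] at this
    exact this
  have h9 := h8 x
  have h10 : dist (g • x) (g ^ 2 • x) = dist x (g • x) := by
    rw [sq, mul_smul, dist_smul]
  have h11 : smulLength X g ^ 2 ≤ dist m (g • m) ^ 2 := by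
    have := smulLength_nonneg (X := X) g
    gcongr
  rw [dist_comm x (g • m), h7] at h1
  rw [dist_self] at h3
  rw [dist_comm (g • x) x] at h3 h9
  rw [dist_comm (g ^ 2 • x) x] at h9
  refine (abs_le_of_sq_le_sq' (a := 2 * smulLength X g) ?_ dist_nonneg).2
  linarith

theorem mem_smulMin_pow_two_pow (hX : IsCAT0 X) {g : Γ} {x : X} (hx : x ∈ smulMin X g) (k : ℕ) :
    x ∈ smulMin X (g ^ 2 ^ k) ∧ smulLength X (g ^ 2 ^ k) = 2 ^ k * smulLength X g := by
  induction k with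
  | zero => simpa using hx
  | succ k ih =>
    have : Nonempty X := ⟨x⟩
    have h1 : ∀ y : X, 2 ^ (k + 1) * smulLength X g ≤ dist y (g ^ 2 ^ (k + 1) • y) := by
      intro y
      have := hX.two_mul_smulLength_le (g ^ 2 ^ k) y
      rw [ih.2, ← pow_mul, ← pow_succ] at this
      rw [pow_succ']
      linarith
    have h2 : 2 ^ (k + 1) * smulLength X g ≤ smulLength X (g ^ 2 ^ (k + 1)) := le_ciInf h1
    have h3 : dist x (g ^ 2 ^ (k + 1) • x) ≤ 2 ^ (k + 1) * smulLength X g := by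
      have h4 := dist_triangle x (g ^ 2 ^ k • x) (g ^ 2 ^ (k + 1) • x)
      have h5 : g ^ 2 ^ (k + 1) • x = g ^ 2 ^ k • g ^ 2 ^ k • x := by
        rw [smul_smul, ← pow_add, pow_succ, mul_two]
      rw [h5] at h4 ⊢
      rw [dist_smul, mem_smulMin.1 ih.1, ih.2] at h4
      rw [pow_succ']
      linarith
    refine ⟨mem_smulMin_of_le (h3.trans h2), le_antisymm ?_ h2⟩
    exact (smulLength_le _ x).trans h3

theorem dist_pow_smul_le (g : Γ) (x : X) (n : ℕ) : dist x (g ^ n • x) ≤ n * dist x (g • x) := by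
  induction n with
  | zero => simp
  | succ n ih =>
    have h := dist_triangle x (g ^ n • x) (g ^ (n + 1) • x)
    rw [pow_succ, mul_smul, dist_smul] at h
    rw [pow_succ, mul_smul]
    push_cast
    linarith

/-- Since g^(2^n) moves `x` by exactly 2^n times the length of one step, no triangle inequality
along the orbit can be strict; this reaches exponents that are not powers of 2. -/
theorem dist_pow_smul (hX : IsCAT0 X) {g : Γ} {x : X} (hx : x ∈ smulMin X g) (n : ℕ) :
    dist x (g ^ n • x) = n * smulLength X g := by
  have hn : n ≤ 2 ^ n := Nat.lt_two_pow_self.le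
  obtain ⟨h1, h2⟩ := hX.mem_smulMin_pow_two_pow hx n
  rw [mem_smulMin, h2] at h1
  have h3 := dist_pow_smul_le g x n
  have h4 := dist_pow_smul_le g x (2 ^ n - n)
  have h5 := dist_triangle x (g ^ n • x) (g ^ 2 ^ n • x)
  have h6 : g ^ 2 ^ n • x = g ^ n • g ^ (2 ^ n - n) • x := by
    rw [smul_smul, ← pow_add, Nat.add_sub_cancel' hn]
  rw [h1, h6, dist_smul] at h5
  rw [mem_smulMin.1 hx] at h3 h4
  rw [Nat.cast_sub hn] at h4
  push_cast at h4
  linarith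

theorem dist_zpow_smul (hX : IsCAT0 X) {g : Γ} {x : X} (hx : x ∈ smulMin X g) (m n : ℤ) :
    dist (g ^ m • x) (g ^ n • x) = |(m : ℝ) - n| * smulLength X g := by
  wlog hmn : m ≤ n generalizing m n
  · rw [dist_comm, abs_sub_comm, this n m (le_of_not_ge hmn)]
  obtain ⟨k, rfl⟩ := Int.le.dest hmn
  rw [zpow_add, mul_smul, dist_smul, zpow_natCast, hX.dist_pow_smul hx]
  simp

end IsCAT0

end MinSets

/-! ### The inner product of translation vectors. -/

section AxialCoordinate

variable {Γ X : Type*} [Group Γ] [MetricSpace X] [MulAction Γ X]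

/-- For `x`, `y` in `Min(g)`, the translation length of `g` times the signed distance from `x` to
the projection of `y` to the axis of `g` through `x`. -/
noncomputable def axialCoord (g : Γ) (x y : X) : ℝ :=
  (smulLength X g ^ 2 + dist x y ^ 2 - dist (g • x) y ^ 2) / 2

theorem axialCoord_self {g : Γ} {x : X} (hx : x ∈ smulMin X g) :
    axialCoord g x x = 0 := by
  rw [axialCoord, dist_self, dist_comm, mem_smulMin.1 hx]; ring

theorem axialCoord_comm {g h : Γ} {x : X} (hg : x ∈ smulMin X g) (hh : x ∈ smulMin X h) :
    axialCoord g x (h • x) = axialCoord h x (g • x) := by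
  rw [axialCoord, axialCoord, mem_smulMin.1 hg, mem_smulMin.1 hh, dist_comm (g • x)]
  ring

theorem axialCoord_smul_self {g : Γ} {x : X} (hx : x ∈ smulMin X g) :
    axialCoord g x (g • x) = smulLength X g ^ 2 := by
  rw [axialCoord, mem_smulMin.1 hx, dist_self]
  ring

variable [IsIsometricSMul Γ X]

theorem axialCoord_smul_smul {g h : Γ} (hgh : Commute g h) (x y : X) :
    axialCoord g (h • x) (h • y) = axialCoord g x y := by
  rw [axialCoord, axialCoord, dist_smul, smul_smul, hgh.eq, mul_smul, dist_smul]

namespace IsCAT0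

/-- The upper bound is the quadrilateral inequality, the lower bound the CN inequality at the
midpoint gⁿx. So d(gⁿx, y)² - l²n² has zero second difference and is affine in n. -/
theorem dist_zpow_smul_recursion (hX : IsCAT0 X) {g : Γ} {x y : X} (hx : x ∈ smulMin X g)
    (hy : y ∈ smulMin X g) (n : ℤ) :
    dist (g ^ (n + 1) • x) y ^ 2 + dist (g ^ (n - 1) • x) y ^ 2 =
      2 * dist (g ^ n • x) y ^ 2 + 2 * smulLength X g ^ 2 := by
  apply le_antisymm
  · have h := hX.quadrilateral (g ^ n • x) (g ^ (n + 1) • x) (g • y) y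
    have h1 : ∀ k : ℤ, dist (g ^ (k + 1) • x) (g • y) = dist (g ^ k • x) y := by
      intro k
      rw [add_comm, zpow_add, zpow_one, mul_smul, dist_smul]
    have h2 := h1 (n - 1)
    rw [sub_add_cancel] at h2
    rw [h1, h2, hX.dist_zpow_smul hx, dist_comm (g • y), mem_smulMin.1 hy,
      dist_comm y] at h
    push_cast at h
    rw [show (n : ℝ) - (n + 1) = -1 by ring, abs_neg, abs_one, one_mul] at h
    linarith
  · have hl := smulLength_nonneg (X := X) g
    have h1 : dist (g ^ (n + 1) • x) (g ^ (n - 1) • x) = 2 * smulLength X g := by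
      rw [hX.dist_zpow_smul hx]
      push_cast
      rw [show (n : ℝ) + 1 - (n - 1) = 2 by ring, abs_two]
    have h2 : dist (g ^ n • x) (g ^ (n + 1) • x) = smulLength X g := by
      rw [hX.dist_zpow_smul hx]
      push_cast
      rw [show (n : ℝ) - (n + 1) = -1 by ring, abs_neg, abs_one, one_mul]
    have h3 : dist (g ^ n • x) (g ^ (n - 1) • x) = smulLength X g := by
      rw [hX.dist_zpow_smul hx]
      push_cast
      rw [show (n : ℝ) - (n - 1) = 1 by ring, abs_one, one_mul]
    have h4 := hX.dist_sq_le_of_isMidpoint (x := g ^ (n + 1) • x) (y := g ^ (n - 1) • x)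
      (m := g ^ n • x) (by rw [h1, h2]; ring) (by rw [h1, h3]; ring) y
    rw [h1] at h4
    linarith

theorem dist_zpow_smul_sq (hX : IsCAT0 X) {g : Γ} {x y : X} (hx : x ∈ smulMin X g)
    (hy : y ∈ smulMin X g) (n : ℤ) :
    dist (g ^ n • x) y ^ 2 =
      dist x y ^ 2 + smulLength X g ^ 2 * n ^ 2 - 2 * n * axialCoord g x y := by
  have hr := hX.dist_zpow_smul_recursion hx hy
  have key : ∀ n : ℕ, ∀ e : ℤ, e = 1 ∨ e = -1 → dist (g ^ (e * n) • x) y ^ 2 =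
      dist x y ^ 2 + smulLength X g ^ 2 * n ^ 2 - 2 * (e * n) * axialCoord g x y := by
    intro n e he
    induction n using Nat.twoStepInduction with
    | zero => simp
    | one =>
      rcases he with rfl | rfl
      · simp [axialCoord]; ring
      · have := hr 0
        simp at this
        simp [axialCoord]; linarith
    | more n h1 h2 =>
      have := hr (e * (n + 1 : ℕ))
      rw [h2] at this
      rcases he with rfl | rfl
      · rw [show (1 : ℤ) * (n + 1 : ℕ) + 1 = 1 * (n + 2 : ℕ) by push_cast; ring,
          show (1 : ℤ) * (n + 1 : ℕ) - 1 = 1 * n by push_cast; ring, h1] at this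
        push_cast at this ⊢
        linarith
      · rw [show (-1 : ℤ) * (n + 1 : ℕ) - 1 = -1 * (n + 2 : ℕ) by push_cast; ring,
          show (-1 : ℤ) * (n + 1 : ℕ) + 1 = -1 * n by push_cast; ring, h1] at this
        push_cast at this ⊢
        linarith
  rcases Int.eq_nat_or_neg n with ⟨k, rfl | rfl⟩
  · have := key k 1 (Or.inl rfl)
    push_cast at this ⊢
    rw [one_mul] at this
    rw [this]; ring
  · have := key k (-1) (Or.inr rfl)
    rw [neg_one_mul] at this
    rw [this]; push_cast; ring

/-- Apply the triangle inequality to g²ⁿx, gⁿy, z. After squaring, the terms in n² cancel, and what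
remains is linear in n and bounded above over all integers n, so its slope is 0. -/
theorem axialCoord_add (hX : IsCAT0 X) {g : Γ} {x y z : X} (hx : x ∈ smulMin X g)
    (hy : y ∈ smulMin X g) (hz : z ∈ smulMin X g) :
    axialCoord g x y + axialCoord g y z = axialCoord g x z := by
  have key : ∀ n : ℤ, 4 * n * (axialCoord g x y + axialCoord g y z - axialCoord g x z) ≤
      2 * dist x y ^ 2 + 2 * dist y z ^ 2 - dist x z ^ 2 := by
    intro n
    have h1 := hX.dist_zpow_smul_sq hx hz (2 * n)
    have h2 := hX.dist_zpow_smul_sq hx hy n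
    have h3 := hX.dist_zpow_smul_sq hy hz n
    have h4 := dist_triangle (g ^ (2 * n) • x) (g ^ n • y) z
    rw [two_mul, zpow_add, mul_smul, dist_smul, ← mul_smul, ← zpow_add, ← two_mul] at h4
    have h5 : dist (g ^ (2 * n) • x) z ^ 2 ≤
        (dist (g ^ n • x) y + dist (g ^ n • y) z) ^ 2 := by gcongr
    have h6 := sq_nonneg (dist (g ^ n • x) y - dist (g ^ n • y) z)
    push_cast at h1
    nlinarith
  set C := 2 * dist x y ^ 2 + 2 * dist y z ^ 2 - dist x z ^ 2
  set D := axialCoord g x y + axialCoord g y z - axialCoord g x z with hD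
  suffices D = 0 by linarith
  by_contra hne
  obtain ⟨n, hn⟩ := exists_nat_gt (C / (4 * |D|))
  have hpos : 0 < |D| := abs_pos.2 hne
  rw [div_lt_iff₀ (by positivity)] at hn
  rcases abs_cases D with ⟨h, -⟩ | ⟨h, -⟩
  · have := key n
    push_cast at this
    rw [h] at hn; linarith
  · have := key (-n)
    push_cast at this
    rw [h] at hn; linarith

theorem axialCoord_swap (hX : IsCAT0 X) {g : Γ} {x y : X} (hx : x ∈ smulMin X g)
    (hy : y ∈ smulMin X g) : axialCoord g y x = -axialCoord g x y := by
  have := hX.axialCoord_add hx hy hx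
  rw [axialCoord_self hx] at this
  linarith

theorem axialCoord_mul (hX : IsCAT0 X) {g h k : Γ} {x : X} (hx : x ∈ smulMin X g)
    (hh : Commute g h) (hk : Commute g k) :
    axialCoord g x ((h * k) • x) = axialCoord g x (h • x) + axialCoord g x (k • x) := by
  rw [← hX.axialCoord_add hx (smul_mem_smulMin hh hx) (smul_mem_smulMin (hh.mul_right hk) hx),
    mul_smul, axialCoord_smul_smul hh]

theorem axialCoord_inv (hX : IsCAT0 X) {g h : Γ} {x : X} (hx : x ∈ smulMin X g)
    (hh : Commute g h) : axialCoord g x (h⁻¹ • x) = -axialCoord g x (h • x) := by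
  have := hX.axialCoord_mul hx hh hh.inv_right
  rw [mul_inv_cancel, one_smul, axialCoord_self hx] at this
  linarith

theorem axialCoord_eq_zero_of_mem_commutator (hX : IsCAT0 X) {g h : Γ} {x : X}
    (hx : x ∈ smulMin X g)
    (hh : h ∈ ⁅Subgroup.centralizer ({g} : Set Γ), Subgroup.centralizer {g}⁆) :
    axialCoord g x (h • x) = 0 := by
  -- The kernel of the homomorphism h ↦ ⟨g, h⟩ on the centralizer of `g`; its target is abelian, so
  -- commutators lie in it.
  let K : Subgroup Γ :=
    { carrier := {k | Commute g k ∧ axialCoord g x (k • x) = 0}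
      one_mem' := ⟨Commute.one_right g, by rw [one_smul, axialCoord_self hx]⟩
      mul_mem' := fun {a b} ha hb => ⟨ha.1.mul_right hb.1, by
        rw [hX.axialCoord_mul hx ha.1 hb.1, ha.2, hb.2, add_zero]⟩
      inv_mem' := fun {a} ha => ⟨ha.1.inv_right, by
        rw [hX.axialCoord_inv hx ha.1, ha.2, neg_zero]⟩ }
  have hK : ⁅Subgroup.centralizer ({g} : Set Γ), Subgroup.centralizer {g}⁆ ≤ K := by
    rw [Subgroup.commutator_le]
    intro a ha b hb
    have ha' : Commute g a := (Subgroup.mem_centralizer_singleton_iff.1 ha).symm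
    have hb' : Commute g b := (Subgroup.mem_centralizer_singleton_iff.1 hb).symm
    refine ⟨((ha'.mul_right hb').mul_right ha'.inv_right).mul_right hb'.inv_right, ?_⟩
    rw [commutatorElement_def,
      hX.axialCoord_mul hx ((ha'.mul_right hb').mul_right ha'.inv_right) hb'.inv_right,
      hX.axialCoord_mul hx (ha'.mul_right hb') ha'.inv_right, hX.axialCoord_mul hx ha' hb',
      hX.axialCoord_inv hx ha', hX.axialCoord_inv hx hb']
    ring
  exact (hK hh).2

/-- An element that is conjugate to its inverse in the centralizer of `g` does not move along the
axes of `g`. -/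
theorem axialCoord_eq_zero_of_conj_eq_inv (hX : IsCAT0 X) {g h c : Γ} {x : X}
    (hx : x ∈ smulMin X g) (hh : Commute g h) (hc : Commute g c) (hch : c⁻¹ * h * c = h⁻¹) :
    axialCoord g x (h • x) = 0 := by
  have h1 := hX.axialCoord_inv hx hh
  rw [← hch, hX.axialCoord_mul hx (hc.inv_right.mul_right hh) hc,
    hX.axialCoord_mul hx hc.inv_right hh, hX.axialCoord_inv hx hc] at h1
  linarith

end IsCAT0

end AxialCoordinate

/-! ### Axes and the flow along them. -/

section Axes

variable {Γ X : Type*} [Group Γ] [MetricSpace X] [MulAction Γ X]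

/-- An axis of `g`, parametrised so that `g` moves each of its points by one unit of time. -/
structure IsAxis (g : Γ) (L : ℝ → X) : Prop where
  dist_eq : ∀ s t, dist (L s) (L t) = smulLength X g * |s - t|
  smul_eq : ∀ s, g • L s = L (s + 1)

namespace IsAxis

variable {g : Γ} {L : ℝ → X}

theorem mem_smulMin (hL : IsAxis g L) (s : ℝ) : L s ∈ smulMin X g := by
  rw [_root_.mem_smulMin, hL.smul_eq, hL.dist_eq]
  simp

theorem zpow_smul_eq (hL : IsAxis g L) (n : ℤ) (s : ℝ) : g ^ n • L s = L (s + n) := by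
  induction n with
  | zero => simp
  | succ n ih =>
    rw [add_comm (n : ℤ), zpow_add, zpow_one, mul_smul, ih, hL.smul_eq]
    push_cast; congr 1; ring
  | pred n ih =>
    rw [sub_eq_neg_add, zpow_add, zpow_neg_one, mul_smul, ih, inv_smul_eq_iff, hL.smul_eq]
    push_cast; congr 1; ring

theorem geodesic (hL : IsAxis g L) (s t : ℝ) :
    IsGeodesicFromTo (fun u => L (s + u * (t - s))) (L s) (L t) where
  start := by simp
  finish := by simp
  dist_eq u _ v _ := by
    rw [hL.dist_eq, hL.dist_eq, show s + u * (t - s) - (s + v * (t - s)) = (u - v) * (t - s) by ring,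
      abs_mul, abs_sub_comm s t]
    ring

theorem axialCoord_eq (hL : IsAxis g L) (s t : ℝ) :
    axialCoord g (L s) (L t) = smulLength X g ^ 2 * (t - s) := by
  rw [axialCoord, hL.smul_eq, hL.dist_eq, hL.dist_eq, mul_pow, mul_pow, sq_abs, sq_abs]
  ring

variable [IsIsometricSMul Γ X]

theorem smul (hL : IsAxis g L) {h : Γ} (hgh : Commute g h) : IsAxis g fun s => h • L s where
  dist_eq s t := by rw [dist_smul, hL.dist_eq]
  smul_eq s := by rw [smul_smul, hgh.eq, mul_smul, hL.smul_eq]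

end IsAxis

namespace IsCAT0

variable {g : Γ}

/-- Convexity of d(L(t), y)² - l²t² in t, with denominators cleared. -/
theorem dist_axis_sq_le (hX : IsCAT0 X) {L : ℝ → X} (hL : IsAxis g L) {s t u : ℝ} (hst : s ≤ t)
    (htu : t ≤ u) (y : X) : (u - s) * (dist (L t) y ^ 2 - smulLength X g ^ 2 * t ^ 2) ≤
      (u - t) * (dist (L s) y ^ 2 - smulLength X g ^ 2 * s ^ 2) +
      (t - s) * (dist (L u) y ^ 2 - smulLength X g ^ 2 * u ^ 2) := by
  rcases eq_or_lt_of_le (hst.trans htu) with h | h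
  · obtain rfl : s = t := le_antisymm hst (htu.trans h.ge)
    subst h; simp
  have hus : 0 < u - s := sub_pos.2 h
  have h1 := hX.dist_sq_le (hL.geodesic s u) (t := (t - s) / (u - s))
    ⟨by apply div_nonneg <;> linarith, by rw [div_le_one hus]; linarith⟩ y
  rw [div_mul_cancel₀ _ hus.ne', add_sub_cancel, hL.dist_eq, mul_pow, sq_abs] at h1
  have h2 := mul_le_mul_of_nonneg_left h1 hus.le
  have h3 : (u - s) * ((1 - (t - s) / (u - s)) * dist (L s) y ^ 2 +
      (t - s) / (u - s) * dist (L u) y ^ 2 -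
      (t - s) / (u - s) * (1 - (t - s) / (u - s)) * (smulLength X g ^ 2 * (s - u) ^ 2)) =
      (u - t) * dist (L s) y ^ 2 + (t - s) * dist (L u) y ^ 2 -
        (t - s) * (u - t) * (u - s) * smulLength X g ^ 2 := by
    field_simp
    ring
  rw [h3] at h2
  linarith

variable [IsIsometricSMul Γ X]

theorem exists_isAxis (hX : IsCAT0 X) {x : X} (hx : x ∈ smulMin X g) :
    ∃ L : ℝ → X, IsAxis g L ∧ L 0 = x := by
  obtain ⟨c, hc⟩ := hX.geodesic x (g • x)
  have hl := smulLength_nonneg (X := X) g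
  have hcd : ∀ s ∈ Set.Icc (0 : ℝ) 1, ∀ t ∈ Set.Icc (0 : ℝ) 1,
      dist (c s) (c t) = smulLength X g * |s - t| := by
    intro s hs t ht
    rw [hc.dist_eq s hs t ht, mem_smulMin.1 hx, mul_comm]
  have hfr : ∀ s : ℝ, Int.fract s ∈ Set.Icc (0 : ℝ) 1 := fun s =>
    ⟨Int.fract_nonneg s, (Int.fract_lt_one s).le⟩
  -- The translates of the geodesic from `x` to `g • x`, laid end to end. The known distances within
  -- the orbit of `x` force equality in the triangle inequalities between them.
  set L : ℝ → X := fun s => g ^ ⌊s⌋ • c (Int.fract s) with hLdef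
  have hleft : ∀ s, dist (g ^ ⌊s⌋ • x) (L s) = smulLength X g * (s - ⌊s⌋) := by
    intro s
    rw [hLdef, dist_smul, ← hc.start, hcd 0 (by simp) _ (hfr s), zero_sub, abs_neg,
      abs_of_nonneg (hfr s).1, Int.fract]
  have hright : ∀ s, dist (L s) (g ^ (⌊s⌋ + 1) • x) = smulLength X g * (⌊s⌋ + 1 - s) := by
    intro s
    rw [hLdef, zpow_add, zpow_one, mul_smul, dist_smul, ← hc.finish, hcd _ (hfr s) 1 (by simp),
      abs_sub_comm, abs_of_nonneg (sub_nonneg.2 (hfr s).2), Int.fract]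
    ring
  have hmid : ∀ m n : ℤ, m ≤ n →
      dist (g ^ m • x) (g ^ n • x) = smulLength X g * (n - m) := by
    intro m n hmn
    have : (m : ℝ) ≤ n := by exact_mod_cast hmn
    rw [hX.dist_zpow_smul hx, abs_sub_comm, abs_of_nonneg (sub_nonneg.2 this), mul_comm]
  have hdist : ∀ s t, s ≤ t → dist (L s) (L t) = smulLength X g * (t - s) := by
    intro s t hst
    have hfl : ⌊s⌋ ≤ ⌊t⌋ := Int.floor_le_floor hst
    apply le_antisymm
    · rcases eq_or_lt_of_le hfl with h | h
      · have h1 : L s = g ^ ⌊t⌋ • c (Int.fract s) := by rw [← h]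
        rw [h1, hLdef, dist_smul, hcd _ (hfr s) _ (hfr t), Int.fract, Int.fract, h,
          abs_sub_comm, abs_of_nonneg (by linarith)]
        apply le_of_eq; ring
      · have h1 := dist_triangle4 (L s) (g ^ (⌊s⌋ + 1) • x) (g ^ ⌊t⌋ • x) (L t)
        rw [hright, hleft, hmid _ _ h] at h1
        push_cast at h1
        linarith
    · have h1 := dist_triangle4 (g ^ ⌊s⌋ • x) (L s) (L t) (g ^ (⌊t⌋ + 1) • x)
      rw [hright, hleft, hmid _ _ (hfl.trans (by simp))] at h1
      push_cast at h1
      linarith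
  refine ⟨L, ⟨fun s t => ?_, fun s => ?_⟩, ?_⟩
  · rcases le_total s t with h | h
    · rw [hdist s t h, abs_sub_comm, abs_of_nonneg (sub_nonneg.2 h)]
    · rw [dist_comm, hdist t s h, abs_of_nonneg (sub_nonneg.2 h)]
  · simp only [hLdef]
    rw [Int.floor_add_one, Int.fract_add_one, add_comm, zpow_add, zpow_one, mul_smul]
  · simp [hLdef, hc.start]

theorem dist_axis_point_sq (hX : IsCAT0 X) {L : ℝ → X} (hL : IsAxis g L) {y : X}
    (hy : y ∈ smulMin X g) (s : ℝ) :
    dist (L s) y ^ 2 = dist (L 0) y ^ 2 + smulLength X g ^ 2 * s ^ 2 -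
      2 * s * axialCoord g (L 0) y := by
  have hint : ∀ n : ℤ, dist (L n) y ^ 2 - smulLength X g ^ 2 * (n : ℝ) ^ 2 = dist (L 0) y ^ 2 -
      2 * n * axialCoord g (L 0) y := by
    intro n
    have h := hX.dist_zpow_smul_sq (hL.mem_smulMin 0) hy n
    rw [hL.zpow_smul_eq, zero_add] at h
    linarith
  have h0 := hint (⌊s⌋ - 1)
  have h1 := hint ⌊s⌋
  have h2 := hint (⌊s⌋ + 1)
  have hs1 := Int.floor_le s
  have hs2 := (Int.lt_floor_add_one s).le
  push_cast at h0 h2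
  -- A convex function that is affine on ℤ is affine: the chord across s bounds it above, the chord
  -- extended from the preceding interval bounds it below.
  have h3 := hX.dist_axis_sq_le hL hs1 hs2 y
  have h4 := hX.dist_axis_sq_le hL (sub_le_self (⌊s⌋ : ℝ) zero_le_one) hs1 y
  rw [h1, h2] at h3
  rw [h1, h0] at h4
  linarith

/-- The flat strip theorem. -/
theorem dist_axis_axis_sq (hX : IsCAT0 X) {L L' : ℝ → X} (hL : IsAxis g L) (hL' : IsAxis g L')
    (s t : ℝ) : dist (L s) (L' t) ^ 2 = dist (L 0) (L' 0) ^ 2 + smulLength X g ^ 2 * (s - t) ^ 2 -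
      2 * (s - t) * axialCoord g (L 0) (L' 0) := by
  have h1 := hX.dist_axis_point_sq hL (hL'.mem_smulMin t) s
  have h2 := hX.dist_axis_point_sq hL' (hL.mem_smulMin 0) t
  rw [dist_comm, dist_comm (L' 0), hX.axialCoord_swap (hL.mem_smulMin 0) (hL'.mem_smulMin 0)] at h2
  rw [← hX.axialCoord_add (hL.mem_smulMin 0) (hL'.mem_smulMin 0) (hL'.mem_smulMin t),
    hL'.axialCoord_eq] at h1
  linarith

theorem isAxis_unique (hX : IsCAT0 X) {L L' : ℝ → X} (hL : IsAxis g L) (hL' : IsAxis g L')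
    (h : L 0 = L' 0) : L = L' := by
  ext s
  have h1 := hX.dist_axis_axis_sq hL hL' s s
  rw [h, axialCoord_self (hL'.mem_smulMin 0)] at h1
  simpa using h1

end IsCAT0

/-- The point reached after time `s` on the axis of `g` through a point `x` of `Min(g)`. -/
noncomputable def axisFlow (g : Γ) (s : ℝ) (x : X) : X :=
  -- Outside Min(g) the value `x` is a mere default.
  open Classical in if h : ∃ L : ℝ → X, IsAxis g L ∧ L 0 = x then h.choose s else x

namespace IsCAT0

variable [IsIsometricSMul Γ X] {g : Γ}

theorem axisFlow_spec (hX : IsCAT0 X) {x : X} (hx : x ∈ smulMin X g) :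
    IsAxis g (fun s => axisFlow g s x) ∧ axisFlow g 0 x = x := by
  have h := hX.exists_isAxis hx
  simp only [axisFlow, dif_pos h]
  exact h.choose_spec

/-- The `h`-translate of the axis of `g` through `x` is an axis of `g` through `h • x`, and that
axis is unique. -/
theorem smul_axisFlow (hX : IsCAT0 X) {x : X} (hx : x ∈ smulMin X g) {h : Γ} (hgh : Commute g h)
    (s : ℝ) : h • axisFlow g s x = axisFlow g s (h • x) := by
  have h1 := hX.axisFlow_spec hx
  have h2 := hX.axisFlow_spec (smul_mem_smulMin hgh hx)
  exact congrFun (hX.isAxis_unique (h1.1.smul hgh) h2.1 (by rw [h1.2, h2.2])) s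

theorem dist_axisFlow_sq (hX : IsCAT0 X) {x y : X} (hx : x ∈ smulMin X g) (hy : y ∈ smulMin X g)
    (s t : ℝ) : dist (axisFlow g s x) (axisFlow g t y) ^ 2 = dist x y ^ 2 +
      smulLength X g ^ 2 * (s - t) ^ 2 - 2 * (s - t) * axialCoord g x y := by
  have h1 := hX.axisFlow_spec hx
  have h2 := hX.axisFlow_spec hy
  simpa only [h1.2, h2.2] using hX.dist_axis_axis_sq h1.1 h2.1 s t

theorem dist_axisFlow (hX : IsCAT0 X) {x y : X} (hx : x ∈ smulMin X g) (hy : y ∈ smulMin X g)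
    (s : ℝ) : dist (axisFlow g s x) (axisFlow g s y) = dist x y := by
  have h := hX.dist_axisFlow_sq hx hy s s
  rw [← sq_eq_sq₀ dist_nonneg dist_nonneg, h]
  ring

theorem axisFlow_mem_smulMin (hX : IsCAT0 X) {x : X} (hx : x ∈ smulMin X g) {h : Γ}
    (hgh : Commute g h) (hxh : x ∈ smulMin X h) (s : ℝ) : axisFlow g s x ∈ smulMin X h := by
  rw [mem_smulMin, hX.smul_axisFlow hx hgh, hX.dist_axisFlow hx (smul_mem_smulMin hgh hx)]
  exact hxh

theorem axialCoord_axisFlow (hX : IsCAT0 X) {h : Γ} (hgh : Commute g h) {x y : X}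
    (hx : x ∈ smulMin X g) (hy : y ∈ smulMin X g) (s : ℝ) :
    axialCoord h (axisFlow g s x) (axisFlow g s y) = axialCoord h x y := by
  rw [axialCoord, axialCoord, hX.smul_axisFlow hx hgh, hX.dist_axisFlow hx hy,
    hX.dist_axisFlow (smul_mem_smulMin hgh hx) hy]

theorem axialCoord_axisFlow_right (hX : IsCAT0 X) {h : Γ} (hgh : Commute g h) {x : X}
    (hx : x ∈ smulMin X g) (hxh : x ∈ smulMin X h) (s : ℝ) :
    axialCoord h x (axisFlow g s x) = s * axialCoord g x (h • x) := by
  have h0 := (hX.axisFlow_spec hx).2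
  have h1 := hX.dist_axisFlow_sq hx hx 0 s
  have h2 := hX.dist_axisFlow_sq (smul_mem_smulMin hgh hx) hx 0 s
  have h3 := (hX.axisFlow_spec (smul_mem_smulMin hgh hx)).2
  rw [h0, axialCoord_self hx, dist_self] at h1
  rw [h3, hX.axialCoord_swap hx (smul_mem_smulMin hgh hx), dist_comm (h • x) x,
    mem_smulMin.1 hxh] at h2
  rw [axialCoord, h1, h2]
  ring

end IsCAT0

end Axes

theorem zpow_smul_eq_of_translates {Γ X E : Type*} [Group Γ] [MulAction Γ X] [AddCommGroup E] [Module ℝ E] {f : E → X} {g : Γ}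
    {v : E} (h : ∀ p, g • f p = f (p + v)) (n : ℤ) (p : E) :
    g ^ n • f p = f (p + (n : ℝ) • v) := by
  induction n with
  | zero => simp
  | succ n ih =>
    rw [add_comm (n : ℤ), zpow_add, zpow_one, mul_smul, ih, h]
    push_cast
    congr 1
    module
  | pred n ih =>
    rw [sub_eq_neg_add, zpow_add, zpow_neg_one, mul_smul, ih, inv_smul_eq_iff, h]
    push_cast
    congr 1
    module

/-! ### The flat spanned by three commuting isometries. -/

section Flats

variable {Γ X : Type*} [Group Γ] [MetricSpace X] [MulAction Γ X]

namespace IsCAT0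

variable [IsIsometricSMul Γ X]

theorem smul_axisFlow_self (hX : IsCAT0 X) {g : Γ} {x : X} (hx : x ∈ smulMin X g) (s : ℝ) :
    g • axisFlow g s x = axisFlow g (s + 1) x :=
  (hX.axisFlow_spec hx).1.smul_eq s

/-- The flows along the axes of three commuting isometries through a common point of their sets
`Min` span a subset on which the metric is given by a quadratic form. -/
theorem dist_axisFlow_three_sq (hX : IsCAT0 X) {a b c : Γ} (hab : Commute a b)
    (hac : Commute a c) (hbc : Commute b c) {x : X} (ha : x ∈ smulMin X a)
    (hb : x ∈ smulMin X b) (hc : x ∈ smulMin X c) (r s t r' s' t' : ℝ) :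
    dist (axisFlow a r (axisFlow b s (axisFlow c t x)))
        (axisFlow a r' (axisFlow b s' (axisFlow c t' x))) ^ 2 =
      smulLength X a ^ 2 * (r - r') ^ 2 + smulLength X b ^ 2 * (s - s') ^ 2 +
      smulLength X c ^ 2 * (t - t') ^ 2 +
      2 * (r - r') * (s - s') * axialCoord b x (a • x) +
      2 * (r - r') * (t - t') * axialCoord c x (a • x) +
      2 * (s - s') * (t - t') * axialCoord c x (b • x) := by
  have hca : ∀ t, axisFlow c t x ∈ smulMin X a := hX.axisFlow_mem_smulMin hc hac.symm ha
  have hcb : ∀ t, axisFlow c t x ∈ smulMin X b := hX.axisFlow_mem_smulMin hc hbc.symm hb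
  have hba : ∀ s t, axisFlow b s (axisFlow c t x) ∈ smulMin X a := fun s t =>
    hX.axisFlow_mem_smulMin (hcb t) hab.symm (hca t) s
  have h1 : ∀ s t, axialCoord a x (axisFlow b s (axisFlow c t x)) =
      t * axialCoord c x (a • x) + s * axialCoord b x (a • x) := by
    intro s t
    rw [← hX.axialCoord_add ha (hca t) (hba s t),
      hX.axialCoord_axisFlow_right hac.symm hc ha,
      hX.axialCoord_axisFlow_right hab.symm (hcb t) (hca t), hX.smul_axisFlow hc hac.symm,
      hX.axialCoord_axisFlow hbc.symm hc (smul_mem_smulMin hac.symm hc)]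
  have h2 : axialCoord b (axisFlow c t x) (axisFlow c t' x) =
      (t' - t) * axialCoord c x (b • x) := by
    have h3 := hX.axialCoord_add hb (hcb t) (hcb t')
    rw [hX.axialCoord_axisFlow_right hbc.symm hc hb,
      hX.axialCoord_axisFlow_right hbc.symm hc hb] at h3
    linarith
  have h3 := hX.axialCoord_add ha (hba s t) (hba s' t')
  rw [h1, h1] at h3
  rw [hX.dist_axisFlow_sq (hba s t) (hba s' t'), hX.dist_axisFlow_sq (hcb t) (hcb t'), h2,
    hX.dist_axisFlow_sq hc hc, dist_self, axialCoord_self hc, ← sub_eq_iff_eq_add'.2 h3.symm]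
  ring

/-- The numerical hypotheses are the Gram matrix of the vectors k(1,1,0), k(1,-1,0), k(1,0,1). -/
theorem exists_flat (hX : IsCAT0 X) {a b c : Γ} (hab : Commute a b)
    (hac : Commute a c) (hbc : Commute b c) {x : X} (ha : x ∈ smulMin X a)
    (hb : x ∈ smulMin X b) (hc : x ∈ smulMin X c) {k : ℝ} (hk : 0 < k)
    (hla : smulLength X a ^ 2 = 2 * k ^ 2) (hlb : smulLength X b ^ 2 = 2 * k ^ 2)
    (hlc : smulLength X c ^ 2 = 2 * k ^ 2) (hba : axialCoord b x (a • x) = 0)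
    (hca : axialCoord c x (a • x) = k ^ 2) (hcb : axialCoord c x (b • x) = k ^ 2) :
    ∃ f : Euc 3 → X, Isometry f ∧ (∀ p, a • f p = f (p + !₂[k, k, 0])) ∧
      (∀ p, b • f p = f (p + !₂[k, -k, 0])) ∧ ∀ p, c • f p = f (p + !₂[k, 0, k]) := by
  have hca' : ∀ t, axisFlow c t x ∈ smulMin X a := hX.axisFlow_mem_smulMin hc hac.symm ha
  have hcb' : ∀ t, axisFlow c t x ∈ smulMin X b := hX.axisFlow_mem_smulMin hc hbc.symm hb
  have hba' : ∀ s t, axisFlow b s (axisFlow c t x) ∈ smulMin X a := fun s t =>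
    hX.axisFlow_mem_smulMin (hcb' t) hab.symm (hca' t) s
  -- The flow times are the coefficients of `p` in that basis.
  refine ⟨fun p => axisFlow a ((p 0 + p 1 - p 2) / (2 * k)) (axisFlow b
    ((p 0 - p 1 - p 2) / (2 * k)) (axisFlow c (p 2 / k) x)), ?_, ?_, ?_, ?_⟩
  · refine Isometry.of_dist_eq fun p q => ?_
    rw [← sq_eq_sq₀ dist_nonneg dist_nonneg,
      hX.dist_axisFlow_three_sq hab hac hbc ha hb hc, hla, hlb, hlc, hba, hca, hcb,
      EuclideanSpace.dist_eq, Real.sq_sqrt (by positivity)]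
    simp only [Fin.sum_univ_three, Real.dist_eq, sq_abs]
    field_simp
    ring
  · intro p
    dsimp only
    rw [hX.smul_axisFlow_self (hba' _ _)]
    congr 2
    · simp; field_simp; ring
    · simp
    · simp
  · intro p
    dsimp only
    rw [hX.smul_axisFlow (hba' _ _) hab, hX.smul_axisFlow_self (hcb' _)]
    congr 2
    · simp; ring
    · simp; field_simp; ring
    · simp
  · intro p
    dsimp only
    rw [hX.smul_axisFlow (hba' _ _) hac, hX.smul_axisFlow (hcb' _) hbc, hX.smul_axisFlow_self hc]
    congr 2
    · simp; ring
    · simp; ring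
    · simp; field_simp

end IsCAT0

end Flats

/-! ### The rhombic dodecahedron as a Voronoi cell. -/

section RhombicDodecahedron

theorem single_mem_standardRhombicDodecahedron (i : Fin 3) {e : ℝ} (he : e = 1 ∨ e = -1) :
    EuclideanSpace.single i e ∈ standardRhombicDodecahedron :=
  subset_convexHull ℝ _ <| Or.inl ⟨i, by rcases he with rfl | rfl <;> simp⟩

theorem cube_mem_standardRhombicDodecahedron {x : Euc 3} (h : ∀ i, x i = 1 / 2 ∨ x i = -1 / 2) :
    x ∈ standardRhombicDodecahedron :=
  subset_convexHull ℝ _ <| Or.inr h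

theorem exists_sign_mul_abs (a : ℝ) : ∃ e : ℝ, (e = 1 ∨ e = -1) ∧ a = e * |a| := by
  rcases abs_cases a with ⟨h, -⟩ | ⟨h, -⟩
  · exact ⟨1, Or.inl rfl, by rw [h, one_mul]⟩
  · exact ⟨-1, Or.inr rfl, by rw [h]; ring⟩

theorem mem_standardRhombicDodecahedron_of_abs_add_abs_le {z : Euc 3}
    (h : ∀ i j, i ≠ j → |z i| + |z j| ≤ 1) : z ∈ standardRhombicDodecahedron := by
  have hconv : Convex ℝ standardRhombicDodecahedron := convex_convexHull ℝ _
  have h0 : (0 : Euc 3) ∈ standardRhombicDodecahedron := by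
    have := hconv (single_mem_standardRhombicDodecahedron 0 (Or.inl rfl))
      (single_mem_standardRhombicDodecahedron 0 (Or.inr rfl)) (a := 1 / 2) (b := 1 / 2)
      (by norm_num) (by norm_num) (by norm_num)
    convert this using 1
    ext j
    fin_cases j <;> simp
  choose e he hz using fun i => exists_sign_mul_abs (z i)
  have hcube : (!₂[e 0 / 2, e 1 / 2, e 2 / 2] : Euc 3) ∈ standardRhombicDodecahedron := by
    refine cube_mem_standardRhombicDodecahedron fun i => ?_
    fin_cases i
    · rcases he 0 with h | h <;> simp [h]
    · rcases he 1 with h | h <;> simp [h]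
    · rcases he 2 with h | h <;> simp [h]
  have key : ∀ i j k : Fin 3, i ≠ j → i ≠ k → j ≠ k → |z k| ≤ |z i| → |z k| ≤ |z j| →
      z ∈ standardRhombicDodecahedron := by
    intro i j k hij hik hjk hi hj
    -- With |z k| smallest, `z` is a convex combination of the cube vertex with its signs, two
    -- signed unit vectors and 0; the first weight is fixed by the coordinate k.
    have hw := hconv.sum_mem (t := Finset.univ)
      (w := ![2 * |z k|, |z i| - |z k|, |z j| - |z k|, 1 - |z i| - |z j|])
      (z := ![!₂[e 0 / 2, e 1 / 2, e 2 / 2], EuclideanSpace.single i (e i),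
        EuclideanSpace.single j (e j), 0]) ?_ ?_ ?_
    · convert hw using 1
      have hk := abs_nonneg (z k)
      ext l
      have hl : l = i ∨ l = j ∨ l = k := by omega
      have hc : ![e 0 / 2, e 1 / 2, e 2 / 2] l = e l / 2 := by fin_cases l <;> rfl
      have hzl := hz l
      simp only [Fin.sum_univ_four, PiLp.add_apply, PiLp.smul_apply, Matrix.cons_val, hc,
        PiLp.single_apply, PiLp.zero_apply, smul_eq_mul]
      rcases hl with rfl | rfl | rfl
      · rw [if_pos rfl, if_neg hij]; linarith
      · rw [if_pos rfl, if_neg hij.symm]; linarith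
      · rw [if_neg hik.symm, if_neg hjk.symm]; linarith
    · intro l _
      have := h i j hij
      have := abs_nonneg (z k)
      fin_cases l <;> simp <;> linarith
    · simp [Fin.sum_univ_four]; ring
    · intro l _
      fin_cases l
      · exact hcube
      · exact single_mem_standardRhombicDodecahedron i (he i)
      · exact single_mem_standardRhombicDodecahedron j (he j)
      · exact h0
  rcases le_total |z 0| |z 1| with h1 | h1 <;> rcases le_total |z 1| |z 2| with h2 | h2 <;>
    rcases le_total |z 0| |z 2| with h3 | h3
  all_goals first
    | exact key 0 1 2 (by decide) (by decide) (by decide) (by linarith) (by linarith)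
    | exact key 0 2 1 (by decide) (by decide) (by decide) (by linarith) (by linarith)
    | exact key 1 2 0 (by decide) (by decide) (by decide) (by linarith) (by linarith)

/-- By convexity only the vertices matter. At ±eᵢ the inequality could fail only for n = ±eᵢ, which
parity excludes; at the cube vertices it follows from |m| ≤ m² for integers m. -/
theorem two_mul_sum_le_of_mem_standardRhombicDodecahedron {z : Euc 3}
    (hz : z ∈ standardRhombicDodecahedron) {n : Fin 3 → ℤ} (hn : Even (n 0 + n 1 + n 2)) :
    2 * (z 0 * n 0 + z 1 * n 1 + z 2 * n 2) ≤ (n 0 : ℝ) ^ 2 + (n 1 : ℝ) ^ 2 + (n 2 : ℝ) ^ 2 := by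
  have hone : ∀ m : ℤ, (m : ℝ) ≤ (m : ℝ) ^ 2 ∧ -(m : ℝ) ≤ (m : ℝ) ^ 2 := fun m => by
    have h1 := Int.le_self_sq m
    have h2 := Int.le_self_sq (-m)
    rw [neg_sq] at h2
    exact ⟨by exact_mod_cast h1, by exact_mod_cast h2⟩
  have htwo : ∀ a b c : ℤ, Even (a + b + c) → 2 * a ≤ a ^ 2 + b ^ 2 + c ^ 2 := by
    intro a b c habc
    by_contra! hlt
    have ha : a = 1 := by nlinarith [sq_nonneg b, sq_nonneg c, sq_nonneg (a - 1)]
    subst ha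
    have hb : b = 0 := by nlinarith [sq_nonneg b, sq_nonneg c]
    have hc : c = 0 := by nlinarith [sq_nonneg b, sq_nonneg c]
    subst hb hc
    exact absurd habc (by decide)
  have hneg : ∀ a b c : ℤ, Even (a + b + c) → -(2 * a) ≤ a ^ 2 + b ^ 2 + c ^ 2 := by
    intro a b c habc
    have := htwo (-a) b c (by
      have h2 : -a + b + c = a + b + c - 2 * a := by ring
      rw [h2]
      exact habc.sub (even_two_mul a))
    linarith
  have hconv : Convex ℝ {z : Euc 3 | 2 * (z 0 * n 0 + z 1 * n 1 + z 2 * n 2) ≤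
      (n 0 : ℝ) ^ 2 + (n 1 : ℝ) ^ 2 + (n 2 : ℝ) ^ 2} := by
    intro x hx y hy a b ha hb hab
    simp only [Set.mem_ofPred_eq, PiLp.add_apply, PiLp.smul_apply, smul_eq_mul] at hx hy ⊢
    have h1 := mul_le_mul_of_nonneg_left hx ha
    have h2 := mul_le_mul_of_nonneg_left hy hb
    have h3 : a * ((n 0 : ℝ) ^ 2 + (n 1 : ℝ) ^ 2 + (n 2 : ℝ) ^ 2) +
        b * ((n 0 : ℝ) ^ 2 + (n 1 : ℝ) ^ 2 + (n 2 : ℝ) ^ 2) =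
        (n 0 : ℝ) ^ 2 + (n 1 : ℝ) ^ 2 + (n 2 : ℝ) ^ 2 := by rw [← add_mul, hab, one_mul]
    linarith
  refine convexHull_min ?_ hconv hz
  rintro x (⟨i, hi⟩ | hx)
  · have h1 := htwo _ _ _ hn
    have h2 := hneg _ _ _ hn
    have h3 := htwo (n 1) (n 0) (n 2) (by rwa [add_comm (n 1)])
    have h4 := hneg (n 1) (n 0) (n 2) (by rwa [add_comm (n 1)])
    have h5 := htwo (n 2) (n 0) (n 1) (by rwa [add_assoc, add_comm (n 2)])
    have h6 := hneg (n 2) (n 0) (n 1) (by rwa [add_assoc, add_comm (n 2)])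
    rify at h1 h2 h3 h4 h5 h6
    fin_cases i <;> rcases hi with rfl | rfl <;> simp <;> linarith
  · have h0 := hone (n 0)
    have h1 := hone (n 1)
    have h2 := hone (n 2)
    simp only [Set.mem_ofPred_eq]
    rcases hx 0 with e0 | e0 <;> rcases hx 1 with e1 | e1 <;> rcases hx 2 with e2 | e2 <;>
      rw [e0, e1, e2] <;> linarith [h0.1, h0.2, h1.1, h1.2, h2.1, h2.2]

theorem Euc.dist_sq_eq (p q : Euc 3) :
    dist p q ^ 2 = (p 0 - q 0) ^ 2 + (p 1 - q 1) ^ 2 + (p 2 - q 2) ^ 2 := by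
  rw [EuclideanSpace.dist_eq, Real.sq_sqrt (by positivity)]
  simp only [Fin.sum_univ_three, Real.dist_eq, sq_abs]

/-- The Dirichlet domains of a face-centred cubic lattice are rhombic dodecahedra. -/
theorem isRhombicDodecahedron_dirichlet_faceCentredCubic {k : ℝ} (hk : 0 < k) (p : Euc 3) :
    IsRhombicDodecahedron {q : Euc 3 | ∀ n : Fin 3 → ℤ, Even (n 0 + n 1 + n 2) →
      dist q p ≤ dist q (p + !₂[k * n 0, k * n 1, k * n 2])} := by
  refine ⟨k, hk, fun z => p + k • z, fun x y => ?_, ?_⟩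
  · rw [dist_add_left, dist_smul₀, Real.norm_of_nonneg hk.le]
  have key : ∀ (z : Euc 3) (n : Fin 3 → ℤ),
      dist (p + k • z) p ≤ dist (p + k • z) (p + !₂[k * n 0, k * n 1, k * n 2]) ↔
        2 * (z 0 * n 0 + z 1 * n 1 + z 2 * n 2) ≤
          (n 0 : ℝ) ^ 2 + (n 1 : ℝ) ^ 2 + (n 2 : ℝ) ^ 2 := by
    intro z n
    rw [← sq_le_sq₀ dist_nonneg dist_nonneg, Euc.dist_sq_eq, Euc.dist_sq_eq]
    simp only [PiLp.add_apply, PiLp.smul_apply, smul_eq_mul, Matrix.cons_val]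
    have hk2 : 0 < k ^ 2 := by positivity
    constructor
    · intro h
      refine le_of_mul_le_mul_left (a := k ^ 2) ?_ hk2
      linarith
    · intro h
      have := mul_le_mul_of_nonneg_left h hk2.le
      linarith
  ext q
  constructor
  · intro hq
    refine ⟨k⁻¹ • (q - p), ?_, by simp [smul_smul, hk.ne']⟩
    set z := k⁻¹ • (q - p) with hz
    have hqz : q = p + k • z := by simp [hz, smul_smul, hk.ne']
    have hq' : ∀ n : Fin 3 → ℤ, Even (n 0 + n 1 + n 2) →
        2 * (z 0 * n 0 + z 1 * n 1 + z 2 * n 2) ≤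
          (n 0 : ℝ) ^ 2 + (n 1 : ℝ) ^ 2 + (n 2 : ℝ) ^ 2 := fun n hn =>
      (key z n).1 (hqz ▸ hq n hn)
    -- The twelve shortest lattice vectors give the twelve faces, that is |zᵢ| + |zⱼ| ≤ 1.
    have h1 := hq' ![1, 1, 0] (by decide)
    have h2 := hq' ![1, -1, 0] (by decide)
    have h3 := hq' ![-1, 1, 0] (by decide)
    have h4 := hq' ![-1, -1, 0] (by decide)
    have h5 := hq' ![1, 0, 1] (by decide)
    have h6 := hq' ![1, 0, -1] (by decide)
    have h7 := hq' ![-1, 0, 1] (by decide)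
    have h8 := hq' ![-1, 0, -1] (by decide)
    have h9 := hq' ![0, 1, 1] (by decide)
    have h10 := hq' ![0, 1, -1] (by decide)
    have h11 := hq' ![0, -1, 1] (by decide)
    have h12 := hq' ![0, -1, -1] (by decide)
    clear hq'
    simp at h1 h2 h3 h4 h5 h6 h7 h8 h9 h10 h11 h12
    have h01 : |z 0| + |z 1| ≤ 1 := by
      rcases abs_cases (z 0) with ⟨e, -⟩ | ⟨e, -⟩ <;> rcases abs_cases (z 1) with ⟨e', -⟩ | ⟨e', -⟩ <;>
        rw [e, e'] <;> linarith
    have h02 : |z 0| + |z 2| ≤ 1 := by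
      rcases abs_cases (z 0) with ⟨e, -⟩ | ⟨e, -⟩ <;> rcases abs_cases (z 2) with ⟨e', -⟩ | ⟨e', -⟩ <;>
        rw [e, e'] <;> linarith
    have h12' : |z 1| + |z 2| ≤ 1 := by
      rcases abs_cases (z 1) with ⟨e, -⟩ | ⟨e, -⟩ <;> rcases abs_cases (z 2) with ⟨e', -⟩ | ⟨e', -⟩ <;>
        rw [e, e'] <;> linarith
    refine mem_standardRhombicDodecahedron_of_abs_add_abs_le fun i j hij => ?_
    fin_cases i <;> fin_cases j <;> simp at hij ⊢ <;> linarith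
  · rintro ⟨z, hz, rfl⟩ n hn
    exact (key z n).2 (two_mul_sum_le_of_mem_standardRhombicDodecahedron hz hn)

end RhombicDodecahedron

/-! ### The action of the face-centred cubic lattice on the flat. -/

section FaceCentredCubic

variable {Γ : Type*} [Group Γ]

theorem exists_eq_zpow_mul_zpow_mul_zpow {a b c : Γ} (hab : Commute a b) (hac : Commute a c)
    (hbc : Commute b c) {g : Γ} (hg : g ∈ Subgroup.closure ({a, b, c} : Set Γ)) :
    ∃ i j k : ℤ, g = a ^ i * b ^ j * c ^ k := by
  induction hg using Subgroup.closure_induction with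
  | mem g hg =>
    rcases hg with rfl | rfl | rfl
    · exact ⟨1, 0, 0, by simp⟩
    · exact ⟨0, 1, 0, by simp⟩
    · exact ⟨0, 0, 1, by simp⟩
  | one => exact ⟨0, 0, 0, by simp⟩
  | mul g h _ _ ihg ihh =>
    obtain ⟨i, j, k, rfl⟩ := ihg
    obtain ⟨i', j', k', rfl⟩ := ihh
    refine ⟨i + i', j + j', k + k', ?_⟩
    have h1 : Commute (c ^ k) (a ^ i' * b ^ j') :=
      (hac.symm.zpow_zpow k i').mul_right (hbc.symm.zpow_zpow k j')
    rw [h1.mul_mul_mul_comm, (hab.symm.zpow_zpow j i').mul_mul_mul_comm, zpow_add, zpow_add,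
      zpow_add]
  | inv g _ ih =>
    obtain ⟨i, j, k, rfl⟩ := ih
    refine ⟨-i, -j, -k, ?_⟩
    have h1 : Commute (c ^ k)⁻¹ (a ^ i * b ^ j)⁻¹ :=
      ((hac.symm.zpow_zpow k i).mul_right (hbc.symm.zpow_zpow k j)).inv_inv
    rw [mul_inv_rev, h1.eq, mul_inv_rev, ((hab.symm.zpow_zpow j i).inv_inv).eq, zpow_neg,
      zpow_neg, zpow_neg]

variable {X : Type*} [MetricSpace X] [MulAction Γ X]

/-- If three commuting elements act on an isometrically embedded 3-flat as translations that
generate a face-centred cubic lattice, then the group generated by them acts on the flat properly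
and cocompactly by translations, and its Dirichlet domains are rhombic dodecahedra. -/
theorem faceCentredCubic_action {a b c : Γ} (hab : Commute a b) (hac : Commute a c)
    (hbc : Commute b c) {k : ℝ} (hk : 0 < k) {f : Euc 3 → X} (hf : Isometry f)
    (ha : ∀ p, a • f p = f (p + !₂[k, k, 0])) (hb : ∀ p, b • f p = f (p + !₂[k, -k, 0]))
    (hc : ∀ p, c • f p = f (p + !₂[k, 0, k])) {A : Subgroup Γ}
    (hA : A = Subgroup.closure {a, b, c}) :
    (∀ g ∈ A, ∃ v : Euc 3, ∀ p : Euc 3, g • f p = f (p + v)) ∧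
      ActsProperlyOn A (Set.range f) ∧ ActsCocompactlyOn A (Set.range f) ∧
      ∀ p : Euc 3, IsRhombicDodecahedron (f ⁻¹' dirichletDomain A (Set.range f) (f p)) := by
  have haA : a ∈ A := hA ▸ Subgroup.subset_closure (by simp)
  have hbA : b ∈ A := hA ▸ Subgroup.subset_closure (by simp)
  have hcA : c ∈ A := hA ▸ Subgroup.subset_closure (by simp)
  have hmem : ∀ l m n : ℤ, a ^ l * b ^ m * c ^ n ∈ A := fun l m n =>
    A.mul_mem (A.mul_mem (A.zpow_mem haA l) (A.zpow_mem hbA m)) (A.zpow_mem hcA n)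
  have hact : ∀ (l m n : ℤ) (p : Euc 3), (a ^ l * b ^ m * c ^ n) • f p =
      f (p + !₂[k * (l + m + n : ℤ), k * (l - m : ℤ), k * n]) := by
    intro l m n p
    rw [mul_smul, mul_smul, zpow_smul_eq_of_translates hc, zpow_smul_eq_of_translates hb,
      zpow_smul_eq_of_translates ha]
    congr 1
    ext i
    fin_cases i <;> simp <;> ring
  have hrep : ∀ g ∈ A, ∃ l m n : ℤ, g = a ^ l * b ^ m * c ^ n := fun g hg =>
    exists_eq_zpow_mul_zpow_mul_zpow hab hac hbc (hA ▸ hg)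
  refine ⟨fun g hg => ?_, ?_, ?_, fun p => ?_⟩
  · obtain ⟨l, m, n, rfl⟩ := hrep g hg
    exact ⟨_, hact l m n⟩
  · intro x _
    -- Nonzero lattice vectors are k times integer vectors, so they have length at least k, and a
    -- ball of radius k/2 meets no translate but its own.
    refine ⟨k / 2, by positivity, (Set.finite_singleton (1 : Γ)).subset ?_⟩
    rintro g ⟨hg, y, ⟨hy, p, rfl⟩, hgy, -⟩
    obtain ⟨l, m, n, rfl⟩ := hrep g hg
    rw [hact] at hgy
    have h1 := dist_triangle_right (f (p + !₂[k * (l + m + n : ℤ), k * (l - m : ℤ), k * n]))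
      (f p) x
    rw [Metric.mem_ball] at hy hgy
    have h2 : dist (p + !₂[k * (l + m + n : ℤ), k * (l - m : ℤ), k * n]) p < k := by
      rw [← hf.dist_eq]; linarith
    have h3 : dist (p + !₂[k * (l + m + n : ℤ), k * (l - m : ℤ), k * n]) p ^ 2 < k ^ 2 := by
      gcongr
    rw [Euc.dist_sq_eq] at h3
    have h4 : k ^ 2 * (((l + m + n) ^ 2 + (l - m) ^ 2 + n ^ 2 : ℤ) : ℝ) < k ^ 2 * 1 := by
      simp at h3
      push_cast
      linarith
    have h5 := lt_of_mul_lt_mul_left h4 (by positivity)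
    have h6 : (l + m + n) ^ 2 + (l - m) ^ 2 + n ^ 2 < 1 := by exact_mod_cast h5
    have hn : n = 0 := by nlinarith [sq_nonneg (l + m + n), sq_nonneg (l - m)]
    have hlm : l - m = 0 := by nlinarith [sq_nonneg (l + m + n), sq_nonneg n]
    have hlmn : l + m + n = 0 := by nlinarith [sq_nonneg (l - m), sq_nonneg n]
    obtain rfl : l = 0 := by omega
    obtain rfl : m = 0 := by omega
    subst hn
    simp
  -- Contains the fundamental parallelepiped, whose points have squared norm at most (9 + 1 + 1)k².
  · refine ⟨f '' Metric.closedBall 0 (5 * k), Set.image_subset_range _ _,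
      (isCompact_closedBall _ _).image hf.continuous, ?_⟩
    rintro _ ⟨p, rfl⟩
    set r := (p 0 + p 1 - p 2) / (2 * k) with hr
    set s := (p 0 - p 1 - p 2) / (2 * k) with hs
    set t := p 2 / k with ht
    have h0 : p 0 = k * (r + s + t) := by rw [hr, hs, ht]; field_simp; ring
    have h1 : p 1 = k * (r - s) := by rw [hr, hs]; field_simp; ring
    have h2 : p 2 = k * t := by rw [ht]; field_simp
    refine ⟨_, hmem ⌊r⌋ ⌊s⌋ ⌊t⌋, f !₂[k * (Int.fract r + Int.fract s + Int.fract t),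
      k * (Int.fract r - Int.fract s), k * Int.fract t], Set.mem_image_of_mem _ ?_, ?_⟩
    · rw [Metric.mem_closedBall]
      refine (abs_le_of_sq_le_sq' ?_ (by positivity : 0 ≤ 5 * k)).2
      rw [Euc.dist_sq_eq]
      have hr0 := Int.fract_nonneg r
      have hr1 := (Int.fract_lt_one r).le
      have hs0 := Int.fract_nonneg s
      have hs1 := (Int.fract_lt_one s).le
      have ht0 := Int.fract_nonneg t
      have ht1 := (Int.fract_lt_one t).le
      have e1 : (Int.fract r + Int.fract s + Int.fract t) ^ 2 ≤ 3 ^ 2 := by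
        gcongr; linarith
      have e2 : (Int.fract r - Int.fract s) ^ 2 ≤ 1 ^ 2 := sq_le_sq' (by linarith) (by linarith)
      have e3 : Int.fract t ^ 2 ≤ 1 ^ 2 := by gcongr
      have e4 : k ^ 2 * ((Int.fract r + Int.fract s + Int.fract t) ^ 2 +
          (Int.fract r - Int.fract s) ^ 2 + Int.fract t ^ 2) ≤ k ^ 2 * 25 := by
        gcongr; linarith
      simp
      linarith
    · rw [hact]
      congr 1
      ext i
      fin_cases i
      · simp [h0]
        linear_combination -k * (Int.floor_add_fract r) - k * (Int.floor_add_fract s) -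
          k * (Int.floor_add_fract t)
      · simp [h1]
        linear_combination -k * (Int.floor_add_fract r) + k * (Int.floor_add_fract s)
      · simp [h2]
        linear_combination -k * (Int.floor_add_fract t)
  · convert isRhombicDodecahedron_dirichlet_faceCentredCubic hk p using 1
    ext q
    simp only [dirichletDomain, Set.mem_preimage, Set.mem_ofPred_eq, Set.mem_range_self, true_and]
    constructor
    · rintro h n ⟨w, hw⟩
      -- The exponents solve l + m + n = n₀, l - m = n₁, n = n₂, using n₀ + n₁ + n₂ = 2w.
      have h1 := h _ (hmem (w - n 2) (w - n 2 - n 1) (n 2))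
      rw [hact, hf.dist_eq, hf.dist_eq] at h1
      rwa [show w - n 2 + (w - n 2 - n 1) + n 2 = n 0 by omega,
        show w - n 2 - (w - n 2 - n 1) = n 1 by omega] at h1
    · intro h g hg
      obtain ⟨l, m, n, rfl⟩ := hrep g hg
      rw [hact, hf.dist_eq, hf.dist_eq]
      exact h ![l + m + n, l - m, n] ⟨l + n, by simp; ring⟩

end FaceCentredCubic

/-! ### The Gram matrix of the translations and the conclusion. -/

theorem proposition4p3 {Γ : Type*} [Group Γ] (α₁ α₂ β₁ β₂ γ : Γ)
    (hcomm : ∀ x ∈ ({α₁, α₂, β₁, β₂} : Set Γ), ∀ y ∈ ({α₁, α₂, β₁, β₂} : Set Γ), Commute x y)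
    (hconj : ∀ x ∈ ({α₁, α₂, β₁, β₂} : Set Γ), ∀ y ∈ ({α₁, α₂, β₁, β₂} : Set Γ), IsConj x y)
    (h_i : α₁ * α₂ = β₁ * β₂)
    (h_ii_α : α₁ ∈ ⁅Subgroup.centralizer {α₂}, Subgroup.centralizer {α₂}⁆)
    (h_ii_β : β₁ ∈ ⁅Subgroup.centralizer {β₂}, Subgroup.centralizer {β₂}⁆)
    (h_iii_mem : γ ∈ Subgroup.centralizer {β₁ * β₂⁻¹})
    (h_iii_conj : γ⁻¹ * (α₁ * α₂⁻¹) * γ = α₂ * α₁⁻¹)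
    (A : Subgroup Γ) (hA : A = Subgroup.closure {α₁, α₂, β₁, β₂})
    {X : Type*} [MetricSpace X] [CompleteSpace X] (hX : IsCAT0 X)
    [MulAction Γ X] [IsIsometricSMul Γ X]
    (hss : ∀ g : Γ, IsSemisimpleMap (fun x : X => g • x)) :
    (∃ x : X, ∀ a ∈ A, a • x = x) ∨
    ∃ f : Euc 3 → X, Isometry f ∧
      (∀ a ∈ A, Set.MapsTo (fun x : X => a • x) (Set.range f) (Set.range f)) ∧
      (∀ a ∈ A, ∃ v : Euc 3, ∀ p : Euc 3, a • f p = f (p + v)) ∧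
      ActsProperlyOn A (Set.range f) ∧
      ActsCocompactlyOn A (Set.range f) ∧
      ∀ p : Euc 3, IsRhombicDodecahedron (f ⁻¹' dirichletDomain A (Set.range f) (f p)) := by
  have c12 : Commute α₁ α₂ := hcomm _ (by simp) _ (by simp)
  have c13 : Commute α₁ β₁ := hcomm _ (by simp) _ (by simp)
  have c14 : Commute α₁ β₂ := hcomm _ (by simp) _ (by simp)
  have c23 : Commute α₂ β₁ := hcomm _ (by simp) _ (by simp)
  have c24 : Commute α₂ β₂ := hcomm _ (by simp) _ (by simp)
  have c34 : Commute β₁ β₂ := hcomm _ (by simp) _ (by simp)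
  have hA' : A = Subgroup.closure {α₁, α₂, β₁} := by
    rw [hA]
    apply le_antisymm
    · rw [Subgroup.closure_le]
      rintro g (rfl | rfl | rfl | rfl)
      · exact Subgroup.subset_closure (by simp)
      · exact Subgroup.subset_closure (by simp)
      · exact Subgroup.subset_closure (by simp)
      · rw [← inv_mul_eq_iff_eq_mul.2 h_i]
        refine Subgroup.mul_mem _ (Subgroup.inv_mem _ ?_) (Subgroup.mul_mem _ ?_ ?_) <;>
          exact Subgroup.subset_closure (by simp)
    · apply Subgroup.closure_mono
      intro g hg
      simp only [Set.mem_insert_iff, Set.mem_singleton_iff] at hg ⊢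
      tauto
  set u := α₁ * α₂⁻¹ with hu
  set w := β₁ * β₂⁻¹ with hw
  have cu1 : Commute α₁ u := (Commute.refl _).mul_right c12.inv_right
  have cu2 : Commute α₂ u := c12.symm.mul_right (Commute.refl _).inv_right
  have cu3 : Commute β₁ u := c13.symm.mul_right c23.symm.inv_right
  have cu4 : Commute β₂ u := c14.symm.mul_right c24.symm.inv_right
  have cw1 : Commute α₁ w := c13.mul_right c14.inv_right
  have cw2 : Commute α₂ w := c23.mul_right c24.inv_right
  have cw3 : Commute β₁ w := (Commute.refl _).mul_right c34.inv_right
  have cw4 : Commute β₂ w := c34.symm.mul_right (Commute.refl _).inv_right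
  have cuw : Commute u w := cw1.mul_left cw2.inv_left
  -- Including `u` and `w` makes the inner product additive and symmetric for them as well.
  obtain ⟨x, hx⟩ := hX.exists_forall_mem_smulMin hss [α₁, α₂, β₁, β₂, u, w] (by
    intro a ha b hb
    simp only [List.mem_cons, List.not_mem_nil, or_false] at ha hb
    rcases ha with rfl | rfl | rfl | rfl | rfl | rfl <;>
      rcases hb with rfl | rfl | rfl | rfl | rfl | rfl <;>
      first | exact Commute.refl _ | assumption | (apply Commute.symm; assumption))
  have hx1 := hx α₁ (by simp)
  have hx2 := hx α₂ (by simp)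
  have hx3 := hx β₁ (by simp)
  have hx4 := hx β₂ (by simp)
  have hxu := hx u (by simp)
  have hxw := hx w (by simp)
  have hl1 : smulLength X α₁ = smulLength X β₁ :=
    smulLength_eq_of_isConj (hconj _ (by simp) _ (by simp))
  have hl2 : smulLength X α₂ = smulLength X β₁ :=
    smulLength_eq_of_isConj (hconj _ (by simp) _ (by simp))
  set l := smulLength X β₁ with hl
  rcases (smulLength_nonneg (X := X) β₁).eq_or_lt with hl0 | hl0
  · refine Or.inl ⟨x, fun a ha => ?_⟩
    have hA1 : A ≤ MulAction.stabilizer Γ x := by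
      rw [hA', Subgroup.closure_le]
      rintro g (rfl | rfl | rfl) <;>
        refine (dist_eq_zero.1 ?_ : x = _ • x).symm
      · rw [mem_smulMin.1 hx1, hl1, hl, ← hl0]
      · rw [mem_smulMin.1 hx2, hl2, hl, ← hl0]
      · rw [mem_smulMin.1 hx3, ← hl0]
    exact hA1 ha
  · right
    have e21 : axialCoord α₂ x (α₁ • x) = 0 := hX.axialCoord_eq_zero_of_mem_commutator hx2 h_ii_α
    have e12 : axialCoord α₁ x (α₂ • x) = 0 := by rw [axialCoord_comm hx1 hx2, e21]
    have e34 : axialCoord β₁ x (β₂ • x) = 0 := by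
      rw [axialCoord_comm hx3 hx4, hX.axialCoord_eq_zero_of_mem_commutator hx4 h_ii_β]
    have ewu : axialCoord w x (u • x) = 0 :=
      hX.axialCoord_eq_zero_of_conj_eq_inv hxw cuw.symm
        (Subgroup.mem_centralizer_singleton_iff.1 h_iii_mem).symm (by
          rw [h_iii_conj, hu, mul_inv_rev, inv_inv])
    have hsum : axialCoord β₁ x (α₁ • x) + axialCoord β₁ x (α₂ • x) = l ^ 2 := by
      rw [← hX.axialCoord_mul hx3 c13.symm c23.symm, h_i,
        hX.axialCoord_mul hx3 (Commute.refl _) c34, e34, add_zero, axialCoord_smul_self hx3]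
    have hdiff : axialCoord u x (β₁ • x) =
        axialCoord β₁ x (α₁ • x) - axialCoord β₁ x (α₂ • x) := by
      rw [axialCoord_comm hxu hx3, hu, hX.axialCoord_mul hx3 c13.symm c23.symm.inv_right,
        hX.axialCoord_inv hx3 c23.symm, sub_eq_add_neg]
    -- ⟨u, β₁ + β₂⟩ = ⟨α₁ - α₂, α₁ + α₂⟩ = l² - l² = 0.
    have hu12 : axialCoord u x (β₁ • x) + axialCoord u x (β₂ • x) = 0 := by
      rw [← hX.axialCoord_mul hxu cu3.symm cu4.symm, ← h_i,
        hX.axialCoord_mul hxu cu1.symm cu2.symm, axialCoord_comm hxu hx1, axialCoord_comm hxu hx2,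
        hu, hX.axialCoord_mul hx1 (Commute.refl _) c12.inv_right, hX.axialCoord_inv hx1 c12,
        hX.axialCoord_mul hx2 c12.symm (Commute.refl _).inv_right,
        hX.axialCoord_inv hx2 (Commute.refl _), axialCoord_smul_self hx1,
        axialCoord_smul_self hx2, e12, e21, hl1, hl2]
      ring
    have huw : axialCoord u x (β₁ • x) - axialCoord u x (β₂ • x) = 0 := by
      rw [← ewu, axialCoord_comm hxw hxu, hw, hX.axialCoord_mul hxu cu3.symm cu4.symm.inv_right,
        hX.axialCoord_inv hxu cu4.symm, sub_eq_add_neg]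
    -- Chosen so that k(1,1,0) has length l.
    set k := l / √2 with hk
    have hk0 : 0 < k := by positivity
    have hlk : l ^ 2 = 2 * k ^ 2 := by
      rw [hk, div_pow, Real.sq_sqrt zero_le_two]
      ring
    obtain ⟨f, hf, h1, h2, h3⟩ := hX.exists_flat c12 c13 c23 hx1 hx2 hx3 hk0
      (by rw [hl1, hlk]) (by rw [hl2, hlk]) hlk e21 (by linarith) (by linarith)
    obtain ⟨htr, hprop, hcoc, hdir⟩ := faceCentredCubic_action c12 c13 c23 hk0 hf h1 h2 h3 hA'
    refine ⟨f, hf, fun a ha => ?_, htr, hprop, hcoc, hdir⟩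
    obtain ⟨v, hv⟩ := htr a ha
    rintro _ ⟨p, rfl⟩
    exact ⟨p + v, (hv p).symm⟩
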